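/- Let $L>0$ and write $Q_T=(0,T)\times(-L,L)$; all functions are complex valued. For $\tau>0$ let $\mathscr R_L(\tau)$ be the set of all $f\in L^2(-L,L)$ for which there are controls $v_-,v_+\in L^2(0,\tau)$ such that the solution $u\in L^2(Q_\tau)$ (in the sense of transposition) of $$\partial_t u-\partial_{xx}u=0 \text{ in } Q_\tau,\qquad u(t,-L)=v_-(t),\quad u(t,L)=v_+(t) \text{ in } (0,\tau),\qquad u(0,\cdot)=0 \text{ in } (-L,L)$$ satisfies $u(\tau,\cdot)=f$. The set $\mathscr R_L(\tau)$ is known not to depend on $\tau>0$; the reachable set $\mathscr R_L$ is this common set, $\mathscr R_L=\bigcap_{\tau>0}\mathscr R_L(\tau)$. Let $T$ satisfy $\pi T>L^2$, let $g\in L^2\big((0,\infty)\times(-L,L)\big)$ be such that $$\int_0^\infty\int_{-L}^{L}|g(t,x)|^2\exp\Big(\frac{L^2-x^2}{2t}\Big)\,dx\,dt<\infty ,$$ and let $w_T\in L^2(-L,L)$. If $w\in C([0,T];L^2(-L,L))$ denotes the solution of $$-\partial_t w-\partial_{xx}w=g \text{ in } Q_T,\qquad w(t,-L)=w(t,L)=0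 \text{ in } (0,T),\qquad w(T,\cdot)=w_T \text{ in } (-L,L),$$ then $w(0,\cdot)\in\mathscr R_L$, that is, $w(0,\cdot)\in\mathscr R_L(\tau)$ for every $\tau>0$. -/

import Mathlib

open MeasureTheory Set
open scoped ContDiff

noncomputable section

namespace HeatReach

/-- Lebesgue measure on the interval `(-L, L)`. -/
abbrev intervalMeasure (L : ℝ) : Measure ℝ := volume.restrict (Ioo (-L) L)

/-- The complex Hilbert space `L²(-L, L)`. -/
abbrev State (L : ℝ) : Type := Lp ℂ 2 (intervalMeasure L)

/-- `∂ₜ φ (t, x)`. -/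
def dt (φ : ℝ × ℝ → ℂ) (t x : ℝ) : ℂ := deriv (fun s => φ (s, x)) t

/-- `∂ₓ φ (t, x)`. -/
def dx (φ : ℝ × ℝ → ℂ) (t x : ℝ) : ℂ := deriv (fun y => φ (t, y)) x

/-- `∂ₓₓ φ (t, x)`. -/
def dxx (φ : ℝ × ℝ → ℂ) (t x : ℝ) : ℂ := iteratedDeriv 2 (fun y => φ (t, y)) x

/-- Test functions for the Dirichlet problem on `[0, T] × [-L, L]`: smooth functions of `(t, x)`
that vanish on the lateral boundary. Nothing is imposed at `t = 0`, at `t = T`, or on the normal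
derivatives at `x = ± L`. -/
structure IsTest (L T : ℝ) (φ : ℝ × ℝ → ℂ) : Prop where
  smooth : ContDiff ℝ ∞ φ
  left : ∀ t ∈ Icc 0 T, φ (t, -L) = 0
  right : ∀ t ∈ Icc 0 T, φ (t, L) = 0

/-- `u ∈ L²((0,T) × (-L,L))` is the solution (in the sense of transposition) of the boundary
controlled heat equation `∂ₜ u - ∂ₓₓ u = 0` in `(0,T) × (-L,L)`, `u(t,-L) = vm(t)`,
`u(t,L) = vp(t)`, `u(0,·) = 0`, and its value at time `T` is `uT`. The identity is what one gets by
multiplying the equation by `φ` and integrating by parts; it encodes the equation, both boundary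
conditions, the zero initial condition and the final value. -/
structure IsControlledSolution (L T : ℝ) (vm vp : ℝ → ℂ) (u : ℝ × ℝ → ℂ) (uT : State L) :
    Prop where
  memLp : MemLp u 2 (volume.restrict (Ioo 0 T ×ˢ Ioo (-L) L))
  identity : ∀ φ : ℝ × ℝ → ℂ, IsTest L T φ →
    (∫ x in Ioo (-L) L, uT x * φ (T, x)) +
        ∫ p in Ioo 0 T ×ˢ Ioo (-L) L, u p * (-dt φ p.1 p.2 - dxx φ p.1 p.2) =
      ∫ t in Ioo 0 T, (vm t * dx φ t (-L) - vp t * dx φ t L)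

/-- The set `R_L(T)` of the states in `L²(-L,L)` that are reached at time `T`, from the zero
state, with controls in `L²(0,T)` at both ends. -/
def reachableSetAt (L T : ℝ) : Set (State L) :=
  {f | ∃ vm vp : ℝ → ℂ,
    MemLp vm 2 (volume.restrict (Ioo 0 T)) ∧ MemLp vp 2 (volume.restrict (Ioo 0 T)) ∧
      ∃ u : ℝ × ℝ → ℂ, IsControlledSolution L T vm vp u f}

/-- The reachable set `R_L`. The sets `R_L(τ)`, `τ > 0`, all coincide by null controllability in
arbitrarily small time; since this is not used here, `R_L` is taken to be their intersection, so
that membership means being reachable in every time horizon. -/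
def reachableSet (L : ℝ) : Set (State L) := ⋂ τ : ℝ, ⋂ _ : 0 < τ, reachableSetAt L τ

/-- `w ∈ C([0,T]; L²(-L,L))` is the solution of the backward problem `-∂ₜ w - ∂ₓₓ w = g` in
`(0,T) × (-L,L)`, `w(t,-L) = w(t,L) = 0`, `w(T,·) = wT`. The equation and the homogeneous
boundary conditions are expressed by integrating by parts against test functions whose normal
derivatives at `x = ± L` are arbitrary. -/
structure IsBackwardSolution (L T : ℝ) (g : ℝ × ℝ → ℂ) (wT : State L) (w : ℝ → State L) :
    Prop where
  continuousOn : ContinuousOn w (Icc 0 T)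
  final : w T = wT
  identity : ∀ φ : ℝ × ℝ → ℂ, IsTest L T φ →
    ∫ t in Ioo 0 T, ∫ x in Ioo (-L) L, w t x * (dt φ t x - dxx φ t x) =
      (∫ p in Ioo 0 T ×ˢ Ioo (-L) L, g p * φ p) +
        (∫ x in Ioo (-L) L, wT x * φ (T, x)) - ∫ x in Ioo (-L) L, w 0 x * φ (0, x)

end HeatReach

end

open MeasureTheory Set
open scoped ContDiff

noncomputable section

namespace HeatReach

/-! The proof is by duality. By Hahn–Banach and Riesz (`mem_reachableSetAt_of_norm_le`), a state `f`
is reachable in time `τ` once `|∫ f φ(τ)|` is bounded, for all test functions `φ`, by the `L²` norms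
of `φₜ + φₓₓ` and of the two normal derivatives. For `f = w(0)`, reverse time, `ψ(t) = φ(τ - t)`,
multiply by a cutoff `χ(t)` equal to `1` near `0` and vanishing from `t₀ = min τ T` on, and test the
equation of `w` with `χψ`. The pairing becomes `∫ g χψ - ∫ w (∂ₜ - ∂ₓₓ)(χψ)`. Cauchy–Schwarz with
the weight of `g` reduces the first term to a bound on `∫∫ |ψ|² exp(-(L² - x²)/(2t))`. The same
bound handles `χ'ψ` in the second, since `χ'` lives where `t ≥ t₀/2`.

The heart is thus `exists_weighted_observability`, in which nothing is known about `ψ(0)`. Put `θ =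
e^{-φ} z` with the Carleman phase `φ = (L² - x²)/(4t)`. The energy `t² ∫ (θₓ² + Vθ²)`, `V = φₜ -
φₓ²`, grows only through the boundary and the source (`weighted_energy_le`), and it tends to `0` as
`t → 0` (`tendsto_weighted_energy_zero`), so it is bounded above by the observation.

Here `V = -L²/(4t²)` is negative, and by Poincaré this energy is coercive only when `π t > L²`.
Coercivity is avoided: the multiplier identity of `integral_sq_le_energy` bounds `∫∫ θ²` by an upper
bound of the energy plus `t₀ ∫ θ(t₀)²`. The latter is controlled by
`exists_integral_sq_le_observation`, an estimate from a steeper, off-centre weight whose potential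
is positive at time `t₀`, for any `t₀ > 0`. -/

/-! ### Integration by parts on space-time rectangles -/

/-- The closed space-time rectangle `[a, b] × [-L, L]`. -/
abbrev rect (L a b : ℝ) : Set (ℝ × ℝ) := Icc a b ×ˢ Icc (-L) L

theorem isCompact_rect (L a b : ℝ) : IsCompact (rect L a b) := isCompact_Icc.prod isCompact_Icc

theorem integrableOn_rect {E : Type*} [NormedAddCommGroup E] {L a b : ℝ} {f : ℝ × ℝ → E}
    (hf : ContinuousOn f (rect L a b)) : IntegrableOn f (rect L a b) :=
  hf.integrableOn_compact (isCompact_rect L a b)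

theorem integral_rect {L a b : ℝ} (hL : 0 ≤ L) (hab : a ≤ b) {f : ℝ × ℝ → ℝ}
    (hf : ContinuousOn f (rect L a b)) :
    ∫ p in rect L a b, f p = ∫ t in a..b, ∫ x in -L..L, f (t, x) := by
  rw [intervalIntegral.integral_of_le hab, ← integral_Icc_eq_integral_Ioc]
  simp only [intervalIntegral.integral_of_le (neg_le_self hL), ← integral_Icc_eq_integral_Ioc]
  exact setIntegral_prod f (integrableOn_rect hf)

theorem integral_rect_swap {L a b : ℝ} (hL : 0 ≤ L) (hab : a ≤ b) {f : ℝ × ℝ → ℝ}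
    (hf : ContinuousOn f (rect L a b)) :
    ∫ p in rect L a b, f p = ∫ x in -L..L, ∫ t in a..b, f (t, x) := by
  rw [integral_rect hL hab hf]
  refine intervalIntegral_intervalIntegral_swap (F := fun t x => f (t, x)) ?_
  refine (integrableOn_rect hf).mono_set ?_
  rw [uIoc_of_le hab, uIoc_of_le (neg_le_self hL)]
  exact prod_mono Ioc_subset_Icc_self Ioc_subset_Icc_self

/-- Divergence theorem on a space-time rectangle, with an inequality for the divergence. -/
theorem integral_sub_integral_le_of_divergence_le {L a b : ℝ} (hL : 0 ≤ L) (hab : a ≤ b)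
    {f f' P P' R : ℝ → ℝ → ℝ}
    (hf : ∀ t ∈ Icc a b, ∀ x ∈ Icc (-L) L, HasDerivAt (fun t => f t x) (f' t x) t)
    (hP : ∀ t ∈ Icc a b, ∀ x ∈ Icc (-L) L, HasDerivAt (fun x => P t x) (P' t x) x)
    (cf : ∀ t ∈ Icc a b, ContinuousOn (f t) (Icc (-L) L))
    (cf' : ContinuousOn (fun p : ℝ × ℝ => f' p.1 p.2) (rect L a b))
    (cP' : ContinuousOn (fun p : ℝ × ℝ => P' p.1 p.2) (rect L a b))
    (cR : ContinuousOn (fun p : ℝ × ℝ => R p.1 p.2) (rect L a b))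
    (h : ∀ t ∈ Icc a b, ∀ x ∈ Icc (-L) L, f' t x - P' t x ≤ R t x) :
    (∫ x in -L..L, f b x) - (∫ x in -L..L, f a x) ≤
      (∫ t in a..b, (P t L - P t (-L))) + ∫ p in rect L a b, R p.1 p.2 := by
  have hLL : -L ≤ L := neg_le_self hL
  have e1 : ∫ p in rect L a b, f' p.1 p.2 = (∫ x in -L..L, f b x) - ∫ x in -L..L, f a x := by
    rw [integral_rect_swap hL hab cf', ← intervalIntegral.integral_sub]
    · refine intervalIntegral.integral_congr fun x hx => ?_
      rw [uIcc_of_le hLL] at hx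
      refine intervalIntegral.integral_eq_sub_of_hasDerivAt (f := fun t => f t x)
        (fun t ht => hf t (by rwa [uIcc_of_le hab] at ht) x hx) ?_
      refine ContinuousOn.intervalIntegrable ?_
      rw [uIcc_of_le hab]
      exact cf'.comp (by fun_prop : Continuous fun t : ℝ => (t, x)).continuousOn
        fun t ht => ⟨ht, hx⟩
    · refine ContinuousOn.intervalIntegrable ?_
      rw [uIcc_of_le hLL]; exact cf b ⟨hab, le_rfl⟩
    · refine ContinuousOn.intervalIntegrable ?_
      rw [uIcc_of_le hLL]; exact cf a ⟨le_rfl, hab⟩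
  have e2 : ∫ p in rect L a b, P' p.1 p.2 = ∫ t in a..b, (P t L - P t (-L)) := by
    rw [integral_rect hL hab cP']
    refine intervalIntegral.integral_congr fun t ht => ?_
    rw [uIcc_of_le hab] at ht
    refine intervalIntegral.integral_eq_sub_of_hasDerivAt (f := fun x => P t x)
      (fun x hx => hP t ht x (by rwa [uIcc_of_le hLL] at hx)) ?_
    refine ContinuousOn.intervalIntegrable ?_
    rw [uIcc_of_le hLL]
    exact cP'.comp (by fun_prop : Continuous fun x : ℝ => (t, x)).continuousOn
      fun x hx => ⟨ht, hx⟩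
  rw [← e1, ← e2, ← sub_le_iff_le_add', ← integral_sub (integrableOn_rect cf')
    (integrableOn_rect cP')]
  refine setIntegral_mono_on ((integrableOn_rect cf').sub (integrableOn_rect cP'))
    (integrableOn_rect cR) (isCompact_rect L a b).measurableSet fun p hp => h _ hp.1 _ hp.2

/-! ### Energy identities for the conjugated heat equation -/

/-- A function of `(t, x)` with the partial derivatives that occur in the energy identities. -/
structure Jet (z zt zx zxx ztx : ℝ → ℝ → ℝ) : Prop where
  t : ∀ t > 0, ∀ x, HasDerivAt (fun t => z t x) (zt t x) t
  x : ∀ t > 0, ∀ x, HasDerivAt (fun x => z t x) (zx t x) x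
  xx : ∀ t > 0, ∀ x, HasDerivAt (fun x => zx t x) (zxx t x) x
  xt : ∀ t > 0, ∀ x, HasDerivAt (fun t => zx t x) (ztx t x) t
  tx : ∀ t > 0, ∀ x, HasDerivAt (fun x => zt t x) (ztx t x) x
  cont : ContinuousOn (fun p : ℝ × ℝ => z p.1 p.2) (Ioi 0 ×ˢ univ)
  cont_t : ContinuousOn (fun p : ℝ × ℝ => zt p.1 p.2) (Ioi 0 ×ˢ univ)
  cont_x : ContinuousOn (fun p : ℝ × ℝ => zx p.1 p.2) (Ioi 0 ×ˢ univ)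
  cont_xx : ContinuousOn (fun p : ℝ × ℝ => zxx p.1 p.2) (Ioi 0 ×ˢ univ)
  cont_tx : ContinuousOn (fun p : ℝ × ℝ => ztx p.1 p.2) (Ioi 0 ×ˢ univ)

/-- The phase `s (A - (x + x₀)²) / t + c t` of the Carleman weights, with `s = n / 8`. -/
def phase (n : ℕ) (A c x₀ t x : ℝ) : ℝ := n / 8 * (A - (x + x₀) ^ 2) / t + c * t

/-- The potential `φₜ - φₓ²` for the phase `φ`. -/
def potential (n : ℕ) (A c x₀ t x : ℝ) : ℝ :=
  c - n / 8 * A / t ^ 2 + (n / 8 - n ^ 2 / 16) * (x + x₀) ^ 2 / t ^ 2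

/-- The coefficient of `θ²` in the dissipation of the weighted energy. -/
def dissipation (n : ℕ) (A c x₀ t x : ℝ) : ℝ :=
  (n ^ 2 / 8 - n / 4) * A / t ^ 3 + (n ^ 2 / 16 - n / 8) * (2 * n - 2) * (x + x₀) ^ 2 / t ^ 3
    - n * c / t

theorem hasDerivAt_potential_t (n : ℕ) (A c x₀ : ℝ) {t : ℝ} (ht : 0 < t) (x : ℝ) :
    HasDerivAt (fun t => potential n A c x₀ t x)
      (n / 4 * A / t ^ 3 - 2 * (n / 8 - n ^ 2 / 16) * (x + x₀) ^ 2 / t ^ 3) t := by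
  unfold potential
  have h : HasDerivAt (fun t : ℝ => t ^ 2) (2 * t) t := by simpa using hasDerivAt_pow 2 t
  have h2 : t ^ 2 ≠ 0 := by positivity
  refine HasDerivAt.congr_deriv ((((hasDerivAt_const t _).div h h2).const_sub c).add
    ((hasDerivAt_const t _).div h h2)) ?_
  field_simp
  ring

theorem hasDerivAt_potential_x (n : ℕ) (A c x₀ t x : ℝ) :
    HasDerivAt (fun x => potential n A c x₀ t x)
      ((n / 8 - n ^ 2 / 16) * (2 * (x + x₀)) / t ^ 2) x := by
  unfold potential
  have h : HasDerivAt (fun x : ℝ => (x + x₀) ^ 2) (2 * (x + x₀)) x := by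
    exact (((hasDerivAt_id x).add_const x₀).pow 2).congr_deriv (by simp)
  exact ((h.const_mul (n / 8 - n ^ 2 / 16 : ℝ)).div_const (t ^ 2)).const_add _

theorem continuousOn_potential (n : ℕ) (A c x₀ : ℝ) :
    ContinuousOn (fun p : ℝ × ℝ => potential n A c x₀ p.1 p.2) (Ioi 0 ×ˢ univ) := by
  unfold potential
  have : ∀ p ∈ (Ioi 0 ×ˢ univ : Set (ℝ × ℝ)), p.1 ^ 2 ≠ 0 :=
    fun p hp => pow_ne_zero _ (ne_of_gt hp.1)
  fun_prop (disch := assumption)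

theorem rect_subset {L a b : ℝ} (ha : 0 < a) : rect L a b ⊆ Ioi 0 ×ˢ univ :=
  fun _ hp => ⟨lt_of_lt_of_le ha hp.1.1, mem_univ _⟩

theorem continuousOn_slice {f : ℝ → ℝ → ℝ}
    (hf : ContinuousOn (fun p : ℝ × ℝ => f p.1 p.2) (Ioi 0 ×ˢ univ)) {t : ℝ} (ht : 0 < t)
    (s : Set ℝ) : ContinuousOn (f t) s :=
  hf.comp (by fun_prop : Continuous fun x : ℝ => (t, x)).continuousOn
    fun _ _ => ⟨ht, mem_univ _⟩

/-- The weighted energy estimate for the conjugated heat equation. -/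
theorem weighted_energy_le {n : ℕ} {A c x₀ L ε t₀ : ℝ} (hL : 0 ≤ L) (hε : 0 < ε) (h0 : ε ≤ t₀)
    {θ θt θx θxx θtx G : ℝ → ℝ → ℝ} (hθ : Jet θ θt θx θxx θtx)
    (heq : ∀ t > 0, ∀ x, G t x = θt t x - θxx t x + potential n A c x₀ t x * θ t x
      + n / 2 * (x + x₀) / t * θx t x + n / 4 / t * θ t x)
    (hW : ∀ t ∈ Icc ε t₀, ∀ x ∈ Icc (-L) L, 0 ≤ dissipation n A c x₀ t x)
    (hl : ∀ t ∈ Icc ε t₀, θ t (-L) = 0 ∧ θt t (-L) = 0)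
    (hr : ∀ t ∈ Icc ε t₀, θ t L = 0 ∧ θt t L = 0) :
    (∫ x in -L..L, t₀ ^ n * (θx t₀ x ^ 2 + potential n A c x₀ t₀ x * θ t₀ x ^ 2)) -
      (∫ x in -L..L, ε ^ n * (θx ε x ^ 2 + potential n A c x₀ ε x * θ ε x ^ 2)) ≤
    (∫ t in ε..t₀, n / 2 * t ^ n / t * ((L + x₀) * θx t L ^ 2 - (-L + x₀) * θx t (-L) ^ 2)) +
      ∫ p in rect L ε t₀, p.1 ^ n * (G p.1 p.2 ^ 2 / 2) := by
  set V := potential n A c x₀ with hV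
  set Vt : ℝ → ℝ → ℝ := fun t x =>
    n / 4 * A / t ^ 3 - 2 * (n / 8 - n ^ 2 / 16) * (x + x₀) ^ 2 / t ^ 3 with hVt
  set Vx : ℝ → ℝ → ℝ := fun t x => (n / 8 - n ^ 2 / 16) * (2 * (x + x₀)) / t ^ 2 with hVx
  have sub := rect_subset (L := L) (b := t₀) hε
  have cV := (continuousOn_potential n A c x₀).mono sub
  have c0 := hθ.cont.mono sub
  have c1 := hθ.cont_t.mono sub
  have c2 := hθ.cont_x.mono sub
  have c3 := hθ.cont_xx.mono sub
  have c4 := hθ.cont_tx.mono sub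
  rw [← hV] at cV
  have pos : ∀ t ∈ Icc ε t₀, 0 < t := fun t ht => hε.trans_le ht.1
  have n1 : ∀ p ∈ rect L ε t₀, p.1 ≠ 0 := fun p hp => (pos _ hp.1).ne'
  have n2 : ∀ p ∈ rect L ε t₀, p.1 ^ 2 ≠ 0 := fun p hp => pow_ne_zero _ (n1 p hp)
  have n3 : ∀ p ∈ rect L ε t₀, p.1 ^ 3 ≠ 0 := fun p hp => pow_ne_zero _ (n1 p hp)
  have cVt : ContinuousOn (fun p : ℝ × ℝ => Vt p.1 p.2) (rect L ε t₀) := by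
    simp only [hVt]; fun_prop (disch := assumption)
  have cVx : ContinuousOn (fun p : ℝ × ℝ => Vx p.1 p.2) (rect L ε t₀) := by
    simp only [hVx]; fun_prop (disch := assumption)
  have cG : ContinuousOn (fun p : ℝ × ℝ => G p.1 p.2) (rect L ε t₀) := by
    have : ContinuousOn (fun p : ℝ × ℝ => θt p.1 p.2 - θxx p.1 p.2 + V p.1 p.2 * θ p.1 p.2
      + n / 2 * (p.2 + x₀) / p.1 * θx p.1 p.2 + n / 4 / p.1 * θ p.1 p.2) (rect L ε t₀) := by
      fun_prop (disch := assumption)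
    exact this.congr fun p hp => heq _ (pos _ hp.1) _
  -- With `y = x + x₀` and `h = -θxx + Vθ`, the time derivative of `θx² + Vθ²` is `2hθt + Vtθ²` plus
  -- the flux `∂ₓ(2 θx θt)`. Inserting the equation for `θt` and integrating `h y θx` and `hθ` by
  -- parts gives the remaining fluxes and a term `-(n/t) θx²`. The factor `t ^ n` cancels exactly
  -- this term; what is left on `θ²` is minus the dissipation.
  have key := integral_sub_integral_le_of_divergence_le hL h0
    (f := fun t x => t ^ n * (θx t x ^ 2 + V t x * θ t x ^ 2))
    (f' := fun t x => n * t ^ n / t * (θx t x ^ 2 + V t x * θ t x ^ 2) +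
      t ^ n * (2 * θx t x * θtx t x + (Vt t x * θ t x ^ 2 + V t x * (2 * θ t x * θt t x))))
    (P := fun t x => t ^ n * (2 * θx t x * θt t x + n / 2 / t *
      ((x + x₀) * θx t x ^ 2 - (x + x₀) * V t x * θ t x ^ 2 + θx t x * θ t x)))
    (P' := fun t x => t ^ n * (2 * θxx t x * θt t x + 2 * θx t x * θtx t x + n / 2 / t *
      ((θx t x ^ 2 + (x + x₀) * (2 * θx t x * θxx t x)) -
        ((V t x + (x + x₀) * Vx t x) * θ t x ^ 2 + (x + x₀) * V t x * (2 * θ t x * θx t x))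
        + (θxx t x * θ t x + θx t x * θx t x))))
    (R := fun t x => t ^ n * (G t x ^ 2 / 2)) ?_ ?_ ?_ ?_ ?_ ?_ ?_
  · refine key.trans_eq ?_
    congr 1
    refine intervalIntegral.integral_congr fun t ht => ?_
    rw [uIcc_of_le h0] at ht
    simp only [(hl t ht).1, (hl t ht).2, (hr t ht).1, (hr t ht).2]
    ring
  · intro t ht x hx
    have tp := pos t ht
    have d1 : HasDerivAt (fun t : ℝ => t ^ n) (n * t ^ n / t) t := by
      refine (hasDerivAt_pow n t).congr_deriv ?_
      rcases n with _ | n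
      · simp
      · field_simp; simp [pow_succ]
    have d2 := hasDerivAt_potential_t n A c x₀ tp x
    have d3 := hθ.t t tp x
    have d4 := hθ.xt t tp x
    refine (d1.mul ((d4.pow 2).add (d2.mul (d3.pow 2)))).congr_deriv ?_
    simp [hV, hVt]
  · intro t ht x hx
    have tp := pos t ht
    have d1 : HasDerivAt (fun x : ℝ => x + x₀) 1 x := (hasDerivAt_id x).add_const x₀
    have d2 := hasDerivAt_potential_x n A c x₀ t x
    have d3 := hθ.x t tp x
    have d4 := hθ.xx t tp x
    have d5 := hθ.tx t tp x
    refine ((((d4.const_mul 2).mul d5).add (((((d1.mul (d4.pow 2)).sub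
      ((d1.mul d2).mul (d3.pow 2)))).add (d4.mul d3)).const_mul (n / 2 / t : ℝ))).const_mul
      (t ^ n)).congr_deriv ?_
    simp [hV, hVx]
  · intro t ht
    have tp := pos t ht
    have a1 := continuousOn_slice hθ.cont tp (Icc (-L) L)
    have a2 := continuousOn_slice hθ.cont_x tp (Icc (-L) L)
    have a3 := continuousOn_slice (continuousOn_potential n A c x₀) tp (Icc (-L) L)
    rw [← hV] at a3
    fun_prop
  · fun_prop (disch := assumption)
  · fun_prop (disch := assumption)
  · fun_prop
  · intro t ht x hx
    have tp := pos t ht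
    set h := -θxx t x + V t x * θ t x with hh
    have hW' := hW t ht x hx
    have e : θt t x = G t x - h - n / 2 * (x + x₀) / t * θx t x - n / 4 / t * θ t x := by
      rw [heq t tp x]; ring
    have e2 : θxx t x = V t x * θ t x - h := by rw [hh]; ring
    have e3 : dissipation n A c x₀ t x =
      -(Vt t x + n / 2 / t * (x + x₀) * Vx t x + n / t * V t x) := by
      simp only [dissipation, hVt, hVx, hV, potential]
      field_simp
      ring
    -- Completing the square in `2hG - 2h²` absorbs `h` and leaves `G²/2`.
    have : t ^ n * (G t x ^ 2 / 2) - t ^ n * (-dissipation n A c x₀ t x * θ t x ^ 2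
        + 2 * h * G t x - 2 * h ^ 2) = t ^ n * (dissipation n A c x₀ t x * θ t x ^ 2
        + 2 * (h - G t x / 2) ^ 2) := by ring
    have p : 0 ≤ t ^ n * (dissipation n A c x₀ t x * θ t x ^ 2 + 2 * (h - G t x / 2) ^ 2) := by
      positivity
    refine le_trans (le_of_eq ?_) (sub_nonneg.1 (p.trans_eq this.symm))
    rw [e3]
    simp only [e, e2]
    field_simp
    ring

/-- An estimate of `θ` in the space-time rectangle by the energy, for the weight
`exp (-(L² - x²) / (4 t))`. -/
theorem integral_sq_le_energy {L ε t₀ : ℝ} (hL : 0 ≤ L) (hε : 0 < ε) (h0 : ε ≤ t₀)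
    {θ θt θx θxx θtx G : ℝ → ℝ → ℝ} (hθ : Jet θ θt θx θxx θtx)
    (heq : ∀ t > 0, ∀ x, G t x = θt t x - θxx t x + potential 2 (L ^ 2) 0 0 t x * θ t x
      + x / t * θx t x + 1 / 2 / t * θ t x)
    (hl : ∀ t ∈ Icc ε t₀, θ t (-L) = 0) (hr : ∀ t ∈ Icc ε t₀, θ t L = 0) :
    ∫ p in rect L ε t₀, θ p.1 p.2 ^ 2 / 2 ≤
    (∫ x in -L..L, t₀ * θ t₀ x ^ 2) +
      ∫ p in rect L ε t₀, (2 * p.1 ^ 2 * G p.1 p.2 ^ 2 + 2 * (p.1 * (θx p.1 p.2 ^ 2 +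
        potential 2 (L ^ 2) 0 0 p.1 p.2 * θ p.1 p.2 ^ 2))) := by
  set V := potential 2 (L ^ 2) 0 0 with hV
  have sub := rect_subset (L := L) (b := t₀) hε
  have cV := (continuousOn_potential 2 (L ^ 2) 0 0).mono sub
  have c0 := hθ.cont.mono sub
  have c1 := hθ.cont_t.mono sub
  have c2 := hθ.cont_x.mono sub
  have c3 := hθ.cont_xx.mono sub
  rw [← hV] at cV
  have pos : ∀ t ∈ Icc ε t₀, 0 < t := fun t ht => hε.trans_le ht.1
  have n1 : ∀ p ∈ rect L ε t₀, p.1 ≠ 0 := fun p hp => (pos _ hp.1).ne'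
  have cG : ContinuousOn (fun p : ℝ × ℝ => G p.1 p.2) (rect L ε t₀) := by
    have : ContinuousOn (fun p : ℝ × ℝ => θt p.1 p.2 - θxx p.1 p.2 + V p.1 p.2 * θ p.1 p.2
      + p.2 / p.1 * θx p.1 p.2 + 1 / 2 / p.1 * θ p.1 p.2) (rect L ε t₀) := by
      fun_prop (disch := assumption)
    exact this.congr fun p hp => heq _ (pos _ hp.1) _
  -- Multiplier `-2tθ`: after integration by parts the transport term leaves `-θ²`, while diffusion
  -- and potential reproduce `2t` times the energy density. The energy is therefore needed from
  -- above only, whatever its sign.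
  have key := integral_sub_integral_le_of_divergence_le hL h0
    (f := fun t x => -(t * θ t x ^ 2))
    (f' := fun t x => -(θ t x ^ 2 + t * (2 * θ t x * θt t x)))
    (P := fun t x => x * θ t x ^ 2 - 2 * t * (θx t x * θ t x))
    (P' := fun t x => θ t x ^ 2 + x * (2 * θ t x * θx t x) -
      2 * t * (θxx t x * θ t x + θx t x * θx t x))
    (R := fun t x => (2 * t ^ 2 * G t x ^ 2 + 2 * (t * (θx t x ^ 2 +
        V t x * θ t x ^ 2))) - θ t x ^ 2 / 2) ?_ ?_ ?_ ?_ ?_ ?_ ?_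
  · have e : ∫ t in ε..t₀, ((fun t x => x * θ t x ^ 2 - 2 * t * (θx t x * θ t x)) t L -
        (fun t x => x * θ t x ^ 2 - 2 * t * (θx t x * θ t x)) t (-L)) = 0 := by
      rw [intervalIntegral.integral_congr (g := fun _ => (0 : ℝ)), intervalIntegral.integral_zero]
      intro t ht
      rw [uIcc_of_le h0] at ht
      simp [hl t ht, hr t ht]
    rw [e, zero_add, integral_sub (integrableOn_rect (by fun_prop))
      (integrableOn_rect (by fun_prop))] at key
    simp only [intervalIntegral.integral_neg] at key
    -- The contribution of the initial time `ε` has a favourable sign and is dropped.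
    have : 0 ≤ ∫ x in -L..L, ε * θ ε x ^ 2 :=
      intervalIntegral.integral_nonneg (neg_le_self hL) fun x _ => by positivity
    linarith
  · intro t ht x hx
    have d3 := hθ.t t (pos t ht) x
    refine ((hasDerivAt_id t).mul (d3.pow 2)).neg.congr_deriv ?_
    simp
  · intro t ht x hx
    have tp := pos t ht
    have d3 := hθ.x t tp x
    have d4 := hθ.xx t tp x
    refine (((hasDerivAt_id x).mul (d3.pow 2)).sub ((d4.mul d3).const_mul (2 * t))).congr_deriv ?_
    simp
  · intro t ht
    have a1 := continuousOn_slice hθ.cont (pos t ht) (Icc (-L) L)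
    fun_prop
  · fun_prop
  · fun_prop
  · fun_prop
  · intro t ht x hx
    have tp := pos t ht
    have e : θt t x = G t x + θxx t x - V t x * θ t x - x / t * θx t x - 1 / 2 / t * θ t x := by
      rw [heq t tp x]; ring
    simp only [e]
    -- Half of the `θ²` obtained is spent on the cross term `2tθG`.
    have : 0 ≤ 2 * (t * G t x + θ t x / 2) ^ 2 := by positivity
    field_simp
    nlinarith [this]

/-! ### Carleman weights and conjugation -/

theorem continuousOn_slice_time {f : ℝ → ℝ → ℝ}
    (hf : ContinuousOn (fun p : ℝ × ℝ => f p.1 p.2) (Ioi 0 ×ˢ univ)) (x : ℝ) {s : Set ℝ}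
    (hs : s ⊆ Ioi 0) : ContinuousOn (fun t => f t x) s :=
  hf.comp (by fun_prop : Continuous fun t : ℝ => (t, x)).continuousOn
    fun _ ht => ⟨hs ht, mem_univ _⟩

/-- The Carleman weight `exp (-φ)` for the phase `φ`. -/
def weight (n : ℕ) (A c x₀ t x : ℝ) : ℝ := Real.exp (-phase n A c x₀ t x)

theorem weight_sq (n : ℕ) (A c x₀ t x : ℝ) :
    weight n A c x₀ t x ^ 2 = Real.exp (-(2 * phase n A c x₀ t x)) := by
  rw [weight, ← Real.exp_nat_mul]; congr 1; push_cast; ring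

theorem weight_sq_le_one {n : ℕ} {A c x₀ t x : ℝ} (hc : 0 ≤ c) (ht : 0 ≤ t)
    (hA : (x + x₀) ^ 2 ≤ A) : weight n A c x₀ t x ^ 2 ≤ 1 := by
  rw [weight_sq, Real.exp_le_one_iff, phase]
  have : 0 ≤ A - (x + x₀) ^ 2 := sub_nonneg.2 hA
  have : 0 ≤ n / 8 * (A - (x + x₀) ^ 2) / t + c * t := by positivity
  linarith

/-- The `x`-derivative of the conjugated function. -/
def conjX (n : ℕ) (A c x₀ : ℝ) (z zx : ℝ → ℝ → ℝ) (t x : ℝ) : ℝ :=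
  weight n A c x₀ t x * (zx t x + n / 4 * (x + x₀) / t * z t x)

/-- The `t`-derivative of the conjugated function. -/
def conjT (n : ℕ) (A c x₀ : ℝ) (z zt : ℝ → ℝ → ℝ) (t x : ℝ) : ℝ :=
  weight n A c x₀ t x * (zt t x + (n / 8 * (A - (x + x₀) ^ 2) / t ^ 2 - c) * z t x)

/-- The second `x`-derivative of the conjugated function. -/
def conjXX (n : ℕ) (A c x₀ : ℝ) (z zx zxx : ℝ → ℝ → ℝ) (t x : ℝ) : ℝ :=
  weight n A c x₀ t x * (zxx t x + n / 2 * (x + x₀) / t * zx t x +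
    (n / 4 / t + (n / 4 * (x + x₀) / t) ^ 2) * z t x)

/-- The mixed derivative of the conjugated function. -/
def conjTX (n : ℕ) (A c x₀ : ℝ) (z zt zx ztx : ℝ → ℝ → ℝ) (t x : ℝ) : ℝ :=
  weight n A c x₀ t x * (ztx t x + n / 4 * (x + x₀) / t * zt t x +
    (n / 8 * (A - (x + x₀) ^ 2) / t ^ 2 - c) * zx t x +
    ((n / 8 * (A - (x + x₀) ^ 2) / t ^ 2 - c) * (n / 4 * (x + x₀) / t)
      - n / 4 * (x + x₀) / t ^ 2) * z t x)

theorem hasDerivAt_weight_t (n : ℕ) (A c x₀ : ℝ) {t : ℝ} (ht : 0 < t) (x : ℝ) :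
    HasDerivAt (fun t => weight n A c x₀ t x)
      (weight n A c x₀ t x * (n / 8 * (A - (x + x₀) ^ 2) / t ^ 2 - c)) t := by
  have h : HasDerivAt (fun t => -phase n A c x₀ t x)
      (n / 8 * (A - (x + x₀) ^ 2) / t ^ 2 - c) t := by
    unfold phase
    refine (((hasDerivAt_const t _).div (hasDerivAt_id t) ht.ne').add
      ((hasDerivAt_id t).const_mul c)).neg.congr_deriv ?_
    simp; ring
  exact h.exp

theorem hasDerivAt_weight_x (n : ℕ) (A c x₀ t x : ℝ) :
    HasDerivAt (fun x => weight n A c x₀ t x)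
      (weight n A c x₀ t x * (n / 4 * (x + x₀) / t)) x := by
  have h : HasDerivAt (fun x => -phase n A c x₀ t x) (n / 4 * (x + x₀) / t) x := by
    unfold phase
    refine ((((((hasDerivAt_id x).add_const x₀).pow 2).const_sub A).const_mul
      (n / 8 : ℝ)).div_const t |>.add_const (c * t)).neg.congr_deriv ?_
    simp; ring
  exact h.exp

theorem continuousOn_weight (n : ℕ) (A c x₀ : ℝ) :
    ContinuousOn (fun p : ℝ × ℝ => weight n A c x₀ p.1 p.2) (Ioi 0 ×ˢ univ) := by
  unfold weight phase
  have : ∀ p ∈ (Ioi 0 ×ˢ univ : Set (ℝ × ℝ)), p.1 ≠ 0 := fun p hp => ne_of_gt hp.1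
  fun_prop (disch := assumption)

section Estimates

variable {z zt zx zxx ztx : ℝ → ℝ → ℝ}

theorem Jet.conj (hz : Jet z zt zx zxx ztx) (n : ℕ) (A c x₀ : ℝ) :
    Jet (fun t x => weight n A c x₀ t x * z t x) (conjT n A c x₀ z zt) (conjX n A c x₀ z zx)
      (conjXX n A c x₀ z zx zxx) (conjTX n A c x₀ z zt zx ztx) := by
  have cw := continuousOn_weight n A c x₀
  have n1 : ∀ p ∈ (Ioi 0 ×ˢ univ : Set (ℝ × ℝ)), p.1 ≠ 0 := fun p hp => ne_of_gt hp.1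
  have n2 : ∀ p ∈ (Ioi 0 ×ˢ univ : Set (ℝ × ℝ)), p.1 ^ 2 ≠ 0 :=
    fun p hp => pow_ne_zero _ (n1 p hp)
  have c0 := hz.cont
  have c1 := hz.cont_t
  have c2 := hz.cont_x
  have c3 := hz.cont_xx
  have c4 := hz.cont_tx
  have lin : ∀ t x : ℝ, HasDerivAt (fun x : ℝ => n / 4 * (x + x₀) / t) (n / 4 / t) x := by
    intro t x
    refine ((((hasDerivAt_id x).add_const x₀).const_mul (n / 4 : ℝ)).div_const t).congr_deriv ?_
    simp
  have lin_t : ∀ t > 0, ∀ x : ℝ, HasDerivAt (fun t : ℝ => n / 4 * (x + x₀) / t)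
      (-(n / 4 * (x + x₀) / t ^ 2)) t := by
    intro t ht x
    refine ((hasDerivAt_const t _).div (hasDerivAt_id t) ht.ne').congr_deriv ?_
    simp; ring
  have quad : ∀ t x : ℝ, HasDerivAt (fun x : ℝ => n / 8 * (A - (x + x₀) ^ 2) / t ^ 2 - c)
      (-(n / 4 * (x + x₀) / t ^ 2)) x := by
    intro t x
    refine ((((((hasDerivAt_id x).add_const x₀).pow 2).const_sub A).const_mul
      (n / 8 : ℝ)).div_const (t ^ 2) |>.sub_const c).congr_deriv ?_
    simp; ring
  constructor
  · intro t ht x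
    refine ((hasDerivAt_weight_t n A c x₀ ht x).mul (hz.t t ht x)).congr_deriv ?_
    simp only [conjT]; ring
  · intro t ht x
    refine ((hasDerivAt_weight_x n A c x₀ t x).mul (hz.x t ht x)).congr_deriv ?_
    simp only [conjX]; ring
  · intro t ht x
    unfold conjX
    refine ((hasDerivAt_weight_x n A c x₀ t x).mul ((hz.xx t ht x).add
      ((lin t x).mul (hz.x t ht x)))).congr_deriv ?_
    simp only [conjXX, Pi.add_apply, Pi.mul_apply]; ring
  · intro t ht x
    unfold conjX
    refine ((hasDerivAt_weight_t n A c x₀ ht x).mul ((hz.xt t ht x).add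
      ((lin_t t ht x).mul (hz.t t ht x)))).congr_deriv ?_
    simp only [conjTX, Pi.add_apply, Pi.mul_apply]; ring
  · intro t ht x
    unfold conjT
    refine ((hasDerivAt_weight_x n A c x₀ t x).mul ((hz.tx t ht x).add
      ((quad t x).mul (hz.x t ht x)))).congr_deriv ?_
    simp only [conjTX, Pi.add_apply, Pi.mul_apply]; ring
  · fun_prop
  · unfold conjT; fun_prop (disch := assumption)
  · unfold conjX; fun_prop (disch := assumption)
  · unfold conjXX; fun_prop (disch := assumption)
  · unfold conjTX; fun_prop (disch := assumption)

/-- Conjugating `∂ₜ - ∂ₓₓ` by `e^{-φ}` adds the potential `φₜ - φₓ²`, the drift `-2φₓ ∂ₓ` and the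
term `-φₓₓ`. This is the form of equation required by the energy identities. -/
theorem conj_equation (n : ℕ) (A c x₀ : ℝ) {t : ℝ} (ht : 0 < t) (x : ℝ) :
    weight n A c x₀ t x * (zt t x - zxx t x) =
      conjT n A c x₀ z zt t x - conjXX n A c x₀ z zx zxx t x +
      potential n A c x₀ t x * (weight n A c x₀ t x * z t x)
      + n / 2 * (x + x₀) / t * conjX n A c x₀ z zx t x
      + n / 4 / t * (weight n A c x₀ t x * z t x) := by
  simp only [conjT, conjXX, conjX, potential]
  field_simp
  ring

/-! ### The Carleman estimate at a fixed time -/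

/-- Energy density of the conjugated function. -/
def energyDensity (n : ℕ) (A c x₀ : ℝ) (z zx : ℝ → ℝ → ℝ) (t x : ℝ) : ℝ :=
  conjX n A c x₀ z zx t x ^ 2 + potential n A c x₀ t x * (weight n A c x₀ t x * z t x) ^ 2

/-- Since `n ≥ 2`, the factor `ε ^ n` absorbs the `ε⁻²` singularities of the energy density. The
integrand is a bounded continuous function times the squared weight, which tends to `0` at every
interior point; dominated convergence concludes. This is why no information on `z` at time `0` is
needed. -/
theorem tendsto_weighted_energy_zero {n : ℕ} (hn : 2 ≤ n) {A c x₀ L : ℝ} (hL : 0 ≤ L)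
    (hc : 0 ≤ c) (hA : ∀ x ∈ Icc (-L) L, (x + x₀) ^ 2 ≤ A)
    (hA' : ∀ x ∈ Ioo (-L) L, (x + x₀) ^ 2 < A)
    (cz : Continuous fun p : ℝ × ℝ => z p.1 p.2) (czx : Continuous fun p : ℝ × ℝ => zx p.1 p.2) :
    Filter.Tendsto (fun ε => ∫ x in -L..L, ε ^ n * energyDensity n A c x₀ z zx ε x)
      (nhdsWithin 0 (Ioi 0)) (nhds 0) := by
  set q : ℝ × ℝ → ℝ := fun p => p.1 ^ (n - 2) * ((p.1 * zx p.1 p.2 +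
    n / 4 * (p.2 + x₀) * z p.1 p.2) ^ 2 + (c * p.1 ^ 2 - n / 8 * A +
      (n / 8 - n ^ 2 / 16) * (p.2 + x₀) ^ 2) * z p.1 p.2 ^ 2) with hq
  have cq : Continuous q := by fun_prop
  have hform : ∀ ε > 0, ∀ x, ε ^ n * energyDensity n A c x₀ z zx ε x =
      weight n A c x₀ ε x ^ 2 * q (ε, x) := by
    intro ε hε x
    have : ε ^ n = ε ^ (n - 2) * ε ^ 2 := by rw [← pow_add, Nat.sub_add_cancel hn]
    simp only [hq, this, energyDensity, conjX, potential]
    field_simp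
  obtain ⟨B, hB⟩ := (isCompact_rect L 0 1).exists_bound_of_continuousOn cq.continuousOn
  have hmem : ∀ᶠ ε in nhdsWithin (0 : ℝ) (Ioi 0), ε ∈ Ioc (0 : ℝ) 1 :=
    Ioc_mem_nhdsGT one_pos
  have hLL : -L ≤ L := neg_le_self hL
  have : Filter.Tendsto (fun ε => ∫ x in -L..L, weight n A c x₀ ε x ^ 2 * q (ε, x))
      (nhdsWithin 0 (Ioi 0)) (nhds (∫ x in -L..L, (0 : ℝ))) := by
    refine intervalIntegral.tendsto_integral_filter_of_dominated_convergence (fun _ => B)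
      ?_ ?_ intervalIntegrable_const ?_
    · filter_upwards [hmem] with ε hε
      refine Continuous.aestronglyMeasurable ?_
      have : Continuous fun x => weight n A c x₀ ε x := by unfold weight phase; fun_prop
      fun_prop
    · filter_upwards [hmem] with ε hε
      refine Filter.Eventually.of_forall fun x hx => ?_
      rw [uIoc_of_le hLL] at hx
      have hx' := Ioc_subset_Icc_self hx
      rw [norm_mul, Real.norm_of_nonneg (sq_nonneg _)]
      have h1 := weight_sq_le_one (n := n) hc hε.1.le (hA x hx')
      have h2 := hB (ε, x) ⟨⟨hε.1.le, hε.2⟩, hx'⟩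
      calc _ ≤ 1 * ‖q (ε, x)‖ := by gcongr
        _ ≤ B := by simpa using h2
    -- At an endpoint `(x + x₀) ^ 2` may equal `A`, and then the weight need not decay.
    · have hne : ∀ᵐ x : ℝ, x ≠ L := by simp [ae_iff]
      filter_upwards [hne] with x hxL hx
      rw [uIoc_of_le hLL] at hx
      have hx' : x ∈ Ioo (-L) L := ⟨hx.1, lt_of_le_of_ne hx.2 hxL⟩
      have hpos := sub_pos.2 (hA' x hx')
      have h1 : Filter.Tendsto (fun ε => q (ε, x)) (nhdsWithin 0 (Ioi 0)) (nhds (q (0, x))) :=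
        ((by fun_prop : Continuous fun ε => q (ε, x)).tendsto 0).mono_left nhdsWithin_le_nhds
      have h2 : Filter.Tendsto (fun ε => weight n A c x₀ ε x ^ 2) (nhdsWithin 0 (Ioi 0))
          (nhds 0) := by
        have h3 : Filter.Tendsto (fun ε : ℝ => -((n / 4 * (A - (x + x₀) ^ 2)) * ε⁻¹))
            (nhdsWithin 0 (Ioi 0)) Filter.atBot := by
          refine Filter.tendsto_neg_atTop_atBot.comp
            (Filter.Tendsto.const_mul_atTop ?_ tendsto_inv_nhdsGT_zero)
          have : (0 : ℝ) < n := by exact_mod_cast (by omega : 0 < n)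
          positivity
        refine squeeze_zero' (Filter.Eventually.of_forall fun _ => sq_nonneg _) ?_
          (Real.tendsto_exp_atBot.comp h3)
        filter_upwards [hmem] with ε hε
        rw [weight_sq, Function.comp_apply, Real.exp_le_exp, phase]
        have : 0 ≤ c * ε := mul_nonneg hc hε.1.le
        have e : (n / 8 * (A - (x + x₀) ^ 2)) / ε = n / 8 * (A - (x + x₀) ^ 2) * ε⁻¹ :=
          div_eq_mul_inv _ _
        rw [e]; linarith
      simpa using h2.mul h1
  rw [intervalIntegral.integral_zero] at this
  refine this.congr' ?_
  filter_upwards [hmem] with ε hε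
  exact intervalIntegral.integral_congr fun x _ => (hform ε hε.1 x).symm

/-- The lateral condition holds on `[0, t₀]` only, so at `t = t₀` the derivative is identified from
one side, by uniqueness of derivatives within the interval. -/
theorem deriv_eq_zero_of_lateral (hz : Jet z zt zx zxx ztx) {t₀ y : ℝ}
    (h : ∀ t ∈ Icc 0 t₀, z t y = 0) {t : ℝ} (ht : t ∈ Ioc 0 t₀) : zt t y = 0 := by
  have hu : UniqueDiffWithinAt ℝ (Icc 0 t₀) t :=
    uniqueDiffOn_Icc (ht.1.trans_le ht.2) t ⟨ht.1.le, ht.2⟩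
  refine hu.eq_deriv _ (hz.t t ht.1 y).hasDerivWithinAt ?_
  exact (hasDerivWithinAt_const t (Icc 0 t₀) (0 : ℝ)).congr h (h t ⟨ht.1.le, ht.2⟩)

/-- Where `z` vanishes, the conjugated normal derivative is the weight times `zx`, and the weight is
at most `1`; also `t ^ (n - 1)` is increasing. The coefficients `L ± x₀` may have either sign: only
their common upper bound `Y`, nonnegative because their sum is `2L`, matters. -/
theorem boundary_density_le {n : ℕ} (hn : 1 ≤ n) {A c x₀ L Y ε t₀ : ℝ} (hL : 0 ≤ L)
    (hc : 0 ≤ c) (hε : 0 < ε) (hA : ∀ x ∈ Icc (-L) L, (x + x₀) ^ 2 ≤ A)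
    (hY : L + x₀ ≤ Y) (hY' : L - x₀ ≤ Y)
    (hl : ∀ t ∈ Icc 0 t₀, z t (-L) = 0) (hr : ∀ t ∈ Icc 0 t₀, z t L = 0) :
    ∀ t ∈ Icc ε t₀, n / 2 * t ^ n / t * ((L + x₀) * conjX n A c x₀ z zx t L ^ 2 -
        (-L + x₀) * conjX n A c x₀ z zx t (-L) ^ 2) ≤
      n / 2 * Y * (t₀ ^ n / t₀) * (zx t L ^ 2 + zx t (-L) ^ 2) := by
  intro t ht
  have hY0 : 0 ≤ Y := by linarith
  have hLm : -L ∈ Icc (-L) L := ⟨le_rfl, neg_le_self hL⟩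
  have hLp : L ∈ Icc (-L) L := ⟨neg_le_self hL, le_rfl⟩
  have t0p : 0 < t₀ := hε.trans_le (ht.1.trans ht.2)
  have tp := hε.trans_le ht.1
  have ht' : t ∈ Icc 0 t₀ := ⟨tp.le, ht.2⟩
  have g1 : conjX n A c x₀ z zx t L ^ 2 ≤ zx t L ^ 2 := by
    have := weight_sq_le_one (n := n) hc tp.le (hA L hLp)
    rw [conjX, hr t ht', mul_zero, add_zero, mul_pow]
    exact mul_le_of_le_one_left (sq_nonneg _) this
  have g2 : conjX n A c x₀ z zx t (-L) ^ 2 ≤ zx t (-L) ^ 2 := by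
    have := weight_sq_le_one (n := n) hc tp.le (hA (-L) hLm)
    rw [conjX, hl t ht', mul_zero, add_zero, mul_pow]
    exact mul_le_of_le_one_left (sq_nonneg _) this
  have g3 : t ^ n / t ≤ t₀ ^ n / t₀ := by
    obtain ⟨m, rfl⟩ : ∃ m, n = m + 1 := ⟨n - 1, by omega⟩
    rw [pow_succ, pow_succ, mul_div_cancel_right₀ _ tp.ne', mul_div_cancel_right₀ _ t0p.ne']
    exact pow_le_pow_left₀ tp.le ht.2 _
  have g4 : (L + x₀) * conjX n A c x₀ z zx t L ^ 2 -
      (-L + x₀) * conjX n A c x₀ z zx t (-L) ^ 2 ≤ Y * (zx t L ^ 2 + zx t (-L) ^ 2) := by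
    have i1 : (L + x₀) * conjX n A c x₀ z zx t L ^ 2 ≤ Y * zx t L ^ 2 :=
      mul_le_mul hY g1 (sq_nonneg _) hY0
    have i2 : (L - x₀) * conjX n A c x₀ z zx t (-L) ^ 2 ≤ Y * zx t (-L) ^ 2 :=
      mul_le_mul hY' g2 (sq_nonneg _) hY0
    linarith
  have g5 : 0 ≤ Y * (zx t L ^ 2 + zx t (-L) ^ 2) := by positivity
  calc _ ≤ n / 2 * t ^ n / t * (Y * (zx t L ^ 2 + zx t (-L) ^ 2)) :=
        mul_le_mul_of_nonneg_left g4 (by positivity)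
    _ = n / 2 * (t ^ n / t) * (Y * (zx t L ^ 2 + zx t (-L) ^ 2)) := by ring
    _ ≤ n / 2 * (t₀ ^ n / t₀) * (Y * (zx t L ^ 2 + zx t (-L) ^ 2)) :=
        mul_le_mul_of_nonneg_right (mul_le_mul_of_nonneg_left g3 (by positivity)) g5
    _ = _ := by ring

theorem boundary_term_le {n : ℕ} (hn : 1 ≤ n) {A c x₀ L Y ε t₀ : ℝ} (hL : 0 ≤ L) (hc : 0 ≤ c)
    (hε : 0 < ε) (h0 : ε ≤ t₀) (hA : ∀ x ∈ Icc (-L) L, (x + x₀) ^ 2 ≤ A)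
    (hY : L + x₀ ≤ Y) (hY' : L - x₀ ≤ Y)
    (hz : Jet z zt zx zxx ztx) (czx : Continuous fun p : ℝ × ℝ => zx p.1 p.2)
    (hl : ∀ t ∈ Icc 0 t₀, z t (-L) = 0) (hr : ∀ t ∈ Icc 0 t₀, z t L = 0) :
    (∫ t in ε..t₀, n / 2 * t ^ n / t * ((L + x₀) * conjX n A c x₀ z zx t L ^ 2 -
        (-L + x₀) * conjX n A c x₀ z zx t (-L) ^ 2)) ≤
      n / 2 * Y * (t₀ ^ n / t₀) * ∫ t in 0..t₀, (zx t L ^ 2 + zx t (-L) ^ 2) := by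
  have hY0 : 0 ≤ Y := by linarith
  have t0p : 0 < t₀ := hε.trans_le h0
  have cb : Continuous fun t => n / 2 * Y * (t₀ ^ n / t₀) * (zx t L ^ 2 + zx t (-L) ^ 2) := by
    have h1 : Continuous fun t => zx t L := czx.comp (by fun_prop : Continuous fun t => (t, L))
    have h2 : Continuous fun t => zx t (-L) := czx.comp (by fun_prop : Continuous fun t => (t, -L))
    fun_prop
  have ne : ∀ t ∈ Icc ε t₀, t ≠ 0 := fun t ht => (hε.trans_le ht.1).ne'
  have sub : Icc ε t₀ ⊆ Ioi 0 := fun t ht => hε.trans_le ht.1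
  have c1 := continuousOn_slice_time (hz.conj n A c x₀).cont_x L sub
  have c2 := continuousOn_slice_time (hz.conj n A c x₀).cont_x (-L) sub
  have step := boundary_density_le (zx := zx) hn hL hc hε hA hY hY' hl hr
  have int1 : IntervalIntegrable (fun t => n / 2 * t ^ n / t *
      ((L + x₀) * conjX n A c x₀ z zx t L ^ 2 - (-L + x₀) * conjX n A c x₀ z zx t (-L) ^ 2))
      volume ε t₀ := by
    refine ContinuousOn.intervalIntegrable ?_
    rw [uIcc_of_le h0]
    fun_prop (disch := assumption)
  have i1 := intervalIntegral.integral_mono_on h0 int1 (cb.intervalIntegrable ε t₀) step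
  have nonneg : 0 ≤ᵐ[volume.restrict (Ioc 0 t₀)]
      fun t => n / 2 * Y * (t₀ ^ n / t₀) * (zx t L ^ 2 + zx t (-L) ^ 2) :=
    Filter.Eventually.of_forall fun t => mul_nonneg (by positivity) (by positivity)
  have i2 := intervalIntegral.integral_mono_interval hε.le h0 le_rfl nonneg
    (cb.intervalIntegrable 0 t₀)
  exact (i1.trans i2).trans_eq (intervalIntegral.integral_const_mul _ _)

theorem source_term_le {n : ℕ} {A c x₀ L ε t₀ : ℝ} (hc : 0 ≤ c)
    (hε : 0 < ε) (h0 : ε ≤ t₀) (hA : ∀ x ∈ Icc (-L) L, (x + x₀) ^ 2 ≤ A)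
    {F : ℝ × ℝ → ℝ} (cF : Continuous F) :
    ∫ p in rect L ε t₀, p.1 ^ n * ((weight n A c x₀ p.1 p.2 * F p) ^ 2 / 2) ≤
      t₀ ^ n / 2 * ∫ p in rect L 0 t₀, F p ^ 2 := by
  have t0p : 0 < t₀ := hε.trans_le h0
  have cw := (continuousOn_weight n A c x₀).mono (rect_subset (L := L) (b := t₀) hε)
  have step : ∀ p ∈ rect L ε t₀, p.1 ^ n * ((weight n A c x₀ p.1 p.2 * F p) ^ 2 / 2) ≤
      t₀ ^ n / 2 * F p ^ 2 := by
    intro p hp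
    have tp := hε.trans_le hp.1.1
    have i1 := mul_le_of_le_one_left (sq_nonneg (F p))
      (weight_sq_le_one (n := n) hc tp.le (hA _ hp.2))
    have i2 := pow_le_pow_left₀ tp.le hp.1.2 n
    rw [mul_pow]
    calc _ ≤ p.1 ^ n * (F p ^ 2 / 2) := mul_le_mul_of_nonneg_left (by linarith) (by positivity)
      _ ≤ t₀ ^ n * (F p ^ 2 / 2) := mul_le_mul_of_nonneg_right i2 (by positivity)
      _ = _ := by ring
  have cF2 : Continuous fun p => t₀ ^ n / 2 * F p ^ 2 := by fun_prop
  rw [← integral_const_mul]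
  refine (setIntegral_mono_on (integrableOn_rect (by fun_prop))
    (integrableOn_rect cF2.continuousOn) (isCompact_rect _ _ _).measurableSet step).trans ?_
  refine setIntegral_mono_set (integrableOn_rect cF2.continuousOn) ?_ ?_
  · refine Filter.Eventually.of_forall fun p => ?_
    show 0 ≤ t₀ ^ n / 2 * F p ^ 2
    positivity
  · exact (prod_mono (Icc_subset_Icc_left hε.le) subset_rfl).eventuallyLE

/-- The Carleman estimate at a fixed time. -/
theorem energy_le_observation {n : ℕ} (hn : 2 ≤ n) {A c x₀ L Y t₀ : ℝ} (hL : 0 ≤ L) (hc : 0 ≤ c)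
    (h0 : 0 < t₀) (hA : ∀ x ∈ Icc (-L) L, (x + x₀) ^ 2 ≤ A)
    (hA' : ∀ x ∈ Ioo (-L) L, (x + x₀) ^ 2 < A) (hY : L + x₀ ≤ Y) (hY' : L - x₀ ≤ Y)
    (hW : ∀ t ∈ Ioc 0 t₀, ∀ x ∈ Icc (-L) L, 0 ≤ dissipation n A c x₀ t x)
    (hz : Jet z zt zx zxx ztx)
    (cz : Continuous fun p : ℝ × ℝ => z p.1 p.2) (czx : Continuous fun p : ℝ × ℝ => zx p.1 p.2)
    (czt : Continuous fun p : ℝ × ℝ => zt p.1 p.2)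
    (czxx : Continuous fun p : ℝ × ℝ => zxx p.1 p.2)
    (hl : ∀ t ∈ Icc 0 t₀, z t (-L) = 0) (hr : ∀ t ∈ Icc 0 t₀, z t L = 0) :
    t₀ * ∫ x in -L..L, energyDensity n A c x₀ z zx t₀ x ≤
      n / 2 * Y * (∫ t in 0..t₀, (zx t L ^ 2 + zx t (-L) ^ 2)) +
        t₀ / 2 * ∫ p in rect L 0 t₀, (zt p.1 p.2 - zxx p.1 p.2) ^ 2 := by
  have main : ∀ ε ∈ Ioc 0 t₀, (∫ x in -L..L, t₀ ^ n * energyDensity n A c x₀ z zx t₀ x) -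
      (n / 2 * Y * (t₀ ^ n / t₀) * (∫ t in 0..t₀, (zx t L ^ 2 + zx t (-L) ^ 2)) +
        t₀ ^ n / 2 * ∫ p in rect L 0 t₀, (zt p.1 p.2 - zxx p.1 p.2) ^ 2) ≤
      ∫ x in -L..L, ε ^ n * energyDensity n A c x₀ z zx ε x := by
    intro ε hε
    have pos : ∀ t ∈ Icc ε t₀, t ∈ Ioc 0 t₀ := fun t ht => ⟨hε.1.trans_le ht.1, ht.2⟩
    have key := weighted_energy_le hL hε.1 hε.2 (hz.conj n A c x₀)
      (G := fun t x => weight n A c x₀ t x * (zt t x - zxx t x))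
      (fun t ht x => conj_equation n A c x₀ ht x) (fun t ht x hx => hW t (pos t ht) x hx)
      (fun t ht => by
        simp [conjT, hl t (Ioc_subset_Icc_self (pos t ht)),
          deriv_eq_zero_of_lateral hz hl (pos t ht)])
      (fun t ht => by
        simp [conjT, hr t (Ioc_subset_Icc_self (pos t ht)),
          deriv_eq_zero_of_lateral hz hr (pos t ht)])
    have bd := boundary_term_le (n := n) (by omega) hL hc hε.1 hε.2 hA hY hY' hz czx hl hr
    have bF := source_term_le (n := n) hc hε.1 hε.2 hA (czt.sub czxx)
    simp only [Pi.sub_apply] at bF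
    simp only [energyDensity]
    linarith
  -- Letting `ε → 0` removes the initial energy; dividing by `t₀ ^ (n - 1)` then gives the
  -- normalised form.
  have lim := ge_of_tendsto (tendsto_weighted_energy_zero hn hL hc hA hA' cz czx)
    (Filter.eventually_of_mem (Ioc_mem_nhdsGT h0) main)
  rw [intervalIntegral.integral_const_mul] at lim
  generalize (∫ x in -L..L, energyDensity n A c x₀ z zx t₀ x) = I at *
  generalize (∫ t in 0..t₀, (zx t L ^ 2 + zx t (-L) ^ 2)) = J at *
  generalize (∫ p in rect L 0 t₀, (zt p.1 p.2 - zxx p.1 p.2) ^ 2) = K at *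
  have hp : 0 < t₀ ^ n / t₀ := by positivity
  refine le_of_mul_le_mul_left ?_ hp
  calc t₀ ^ n / t₀ * (t₀ * I) = t₀ ^ n * I := by field_simp
    _ ≤ n / 2 * Y * (t₀ ^ n / t₀) * J + t₀ ^ n / 2 * K := by linarith
    _ = _ := by field_simp

/-! ### Observability of the final state -/

/-- The boundary observation plus the square of the source term, on `(0, t₀)`. -/
def observation (L t₀ : ℝ) (zt zx zxx : ℝ → ℝ → ℝ) : ℝ :=
  (∫ t in 0..t₀, (zx t L ^ 2 + zx t (-L) ^ 2)) +
    ∫ p in rect L 0 t₀, (zt p.1 p.2 - zxx p.1 p.2) ^ 2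

theorem le_mul_observation {L t₀ a b : ℝ} (h0 : 0 ≤ t₀) (ha : 0 ≤ a) (hb : 0 ≤ b) :
    a * (∫ t in 0..t₀, (zx t L ^ 2 + zx t (-L) ^ 2)) +
        b * (∫ p in rect L 0 t₀, (zt p.1 p.2 - zxx p.1 p.2) ^ 2) ≤
      (a + b) * observation L t₀ zt zx zxx := by
  have h1 : 0 ≤ ∫ t in 0..t₀, (zx t L ^ 2 + zx t (-L) ^ 2) :=
    intervalIntegral.integral_nonneg h0 fun t _ => by positivity
  have h2 : 0 ≤ ∫ p in rect L 0 t₀, (zt p.1 p.2 - zxx p.1 p.2) ^ 2 :=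
    integral_nonneg fun p => sq_nonneg _
  rw [observation]
  nlinarith [mul_nonneg ha h2, mul_nonneg hb h1]

/-- Final-state observability in arbitrary time. -/
theorem exists_integral_sq_le_observation {L t₀ : ℝ} (hL : 0 < L) (h0 : 0 < t₀) :
    ∃ C, 0 ≤ C ∧ ∀ z zt zx zxx ztx : ℝ → ℝ → ℝ, Jet z zt zx zxx ztx →
      (Continuous fun p : ℝ × ℝ => z p.1 p.2) → (Continuous fun p : ℝ × ℝ => zx p.1 p.2) →
      (Continuous fun p : ℝ × ℝ => zt p.1 p.2) → (Continuous fun p : ℝ × ℝ => zxx p.1 p.2) →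
      (∀ t ∈ Icc 0 t₀, z t (-L) = 0) → (∀ t ∈ Icc 0 t₀, z t L = 0) →
      ∫ x in -L..L, z t₀ x ^ 2 ≤ C * observation L t₀ zt zx zxx := by
  -- For `n > 2` the first two terms of the dissipation are positive and leave room for `c > 0`. The
  -- shift `9L` puts `y = x + 9L` in `[8L, 10L]`, with `A = 100 L²` the maximum of `y²`. With `n =
  -- 16`, the value `1601 = 200 + 14 · 100 + 1` gives a potential of at least `L²/t₀²` at time `t₀`,
  -- and the dissipation stays nonnegative because `2800 + 420 · 64 ≥ 16 · 1601`.
  set c : ℝ := 1601 * L ^ 2 / t₀ ^ 2 with hc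
  -- A lower bound at time `t₀` for the potential times the squared weight.
  set m : ℝ := L ^ 2 / t₀ ^ 2 * Real.exp (-(2 * (200 * L ^ 2 / t₀ + c * t₀))) with hm
  have mpos : 0 < m := by positivity
  have cpos : 0 ≤ c := by positivity
  refine ⟨(t₀ * m)⁻¹ * ((16 : ℕ) / 2 * (10 * L) + t₀ / 2), by positivity, ?_⟩
  intro z zt zx zxx ztx hz cz czx czt czxx hl hr
  have hy : ∀ x ∈ Icc (-L) L, 64 * L ^ 2 ≤ (x + 9 * L) ^ 2 ∧ (x + 9 * L) ^ 2 ≤ 100 * L ^ 2 :=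
    fun x hx => ⟨by nlinarith [hx.1, hx.2], by nlinarith [hx.1, hx.2]⟩
  have key := energy_le_observation (n := 16) (by norm_num) (A := 100 * L ^ 2) (c := c)
    (x₀ := 9 * L) (Y := 10 * L) hL.le cpos h0 (fun x hx => (hy x hx).2)
    (fun x hx => by nlinarith [hx.1, hx.2]) (by linarith) (by linarith) ?_ hz cz czx czt czxx hl hr
  · have key2 := key.trans (le_mul_observation h0.le (by positivity) (by positivity))
    have low : m * ∫ x in -L..L, z t₀ x ^ 2 ≤
        ∫ x in -L..L, energyDensity 16 (100 * L ^ 2) c (9 * L) z zx t₀ x := by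
      rw [← intervalIntegral.integral_const_mul]
      have hj := hz.conj 16 (100 * L ^ 2) c (9 * L)
      have a1 := continuousOn_slice (f := fun t x => weight 16 (100 * L ^ 2) c (9 * L) t x * z t x)
        hj.cont h0 (Icc (-L) L)
      have a2 := continuousOn_slice hj.cont_x h0 (Icc (-L) L)
      have a3 := continuousOn_slice (continuousOn_potential 16 (100 * L ^ 2) c (9 * L)) h0
        (Icc (-L) L)
      have a4 := continuousOn_slice hz.cont h0 (Icc (-L) L)
      refine intervalIntegral.integral_mono_on (neg_le_self hL.le) ?_ ?_ fun x hx => ?_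
      · refine ContinuousOn.intervalIntegrable ?_
        rw [uIcc_of_le (neg_le_self hL.le)]
        fun_prop
      · refine ContinuousOn.intervalIntegrable ?_
        rw [uIcc_of_le (neg_le_self hL.le)]
        unfold energyDensity
        fun_prop
      · have hV : L ^ 2 / t₀ ^ 2 ≤ potential 16 (100 * L ^ 2) c (9 * L) t₀ x := by
          have e : potential 16 (100 * L ^ 2) c (9 * L) t₀ x =
              (1601 * L ^ 2 - 200 * L ^ 2 - 14 * (x + 9 * L) ^ 2) / t₀ ^ 2 := by
            simp only [potential, hc]; push_cast; field_simp; ring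
          rw [e]
          gcongr
          linarith [(hy x hx).2]
        have hw : Real.exp (-(2 * (200 * L ^ 2 / t₀ + c * t₀))) ≤
            weight 16 (100 * L ^ 2) c (9 * L) t₀ x ^ 2 := by
          rw [weight_sq, Real.exp_le_exp, phase]
          have : ((16 : ℕ) : ℝ) / 8 * (100 * L ^ 2 - (x + 9 * L) ^ 2) / t₀ ≤ 200 * L ^ 2 / t₀ := by
            push_cast
            rw [div_le_div_iff_of_pos_right h0]
            nlinarith [sq_nonneg (x + 9 * L)]
          linarith
        rw [energyDensity, mul_pow]
        calc m * z t₀ x ^ 2 ≤ potential 16 (100 * L ^ 2) c (9 * L) t₀ x *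
              weight 16 (100 * L ^ 2) c (9 * L) t₀ x ^ 2 * z t₀ x ^ 2 := by
              rw [hm]; gcongr
              exact le_trans (by positivity) hV
          _ ≤ _ := by nlinarith [sq_nonneg (conjX 16 (100 * L ^ 2) c (9 * L) z zx t₀ x)]
    have : (t₀ * m) * ∫ x in -L..L, z t₀ x ^ 2 ≤
        ((16 : ℕ) / 2 * (10 * L) + t₀ / 2) * observation L t₀ zt zx zxx := by
      refine le_trans ?_ key2
      rw [mul_assoc]; gcongr
    rw [mul_assoc, ← div_eq_inv_mul, le_div_iff₀ (by positivity)]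
    linarith
  · intro t ht x hx
    have e : dissipation 16 (100 * L ^ 2) c (9 * L) t x =
        (2800 * L ^ 2 + 420 * (x + 9 * L) ^ 2 - 16 * (c * t ^ 2)) / t ^ 3 := by
      have := ht.1
      simp only [dissipation]; push_cast; field_simp; ring
    rw [e]
    have : c * t ^ 2 ≤ 1601 * L ^ 2 := by
      calc c * t ^ 2 ≤ c * t₀ ^ 2 := by
            have := ht.1.le
            have := ht.2
            gcongr
        _ = _ := by rw [hc]; field_simp
    refine div_nonneg ?_ (pow_nonneg ht.1.le 3)
    nlinarith [(hy x hx).1, sq_nonneg L]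

/-! ### Gaussian-weighted observability in space-time -/

theorem integral_rect_le {L a b M : ℝ} (hL : 0 ≤ L) (hab : a ≤ b) {f : ℝ × ℝ → ℝ}
    (hf : ContinuousOn f (rect L a b)) (hM : ∀ t ∈ Icc a b, ∫ x in -L..L, f (t, x) ≤ M) :
    ∫ p in rect L a b, f p ≤ (b - a) * M := by
  have hLL : -L ≤ L := neg_le_self hL
  have hi : Integrable f ((volume.restrict (Icc a b)).prod (volume.restrict (Icc (-L) L))) := by
    rw [Measure.prod_restrict]; exact integrableOn_rect hf
  have h1 : IntervalIntegrable (fun t => ∫ x in -L..L, f (t, x)) volume a b := by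
    simp only [intervalIntegral.integral_of_le hLL, ← integral_Icc_eq_integral_Ioc]
    rw [intervalIntegrable_iff_integrableOn_Icc_of_le hab]
    exact hi.integral_prod_left
  rw [integral_rect hL hab hf]
  calc _ ≤ ∫ _ in a..b, M :=
        intervalIntegral.integral_mono_on hab h1 intervalIntegrable_const hM
    _ = _ := by simp

theorem observation_mono {L s t : ℝ} (hs : 0 ≤ s) (hst : s ≤ t)
    (czx : Continuous fun p : ℝ × ℝ => zx p.1 p.2)
    (czt : Continuous fun p : ℝ × ℝ => zt p.1 p.2)
    (czxx : Continuous fun p : ℝ × ℝ => zxx p.1 p.2) :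
    observation L s zt zx zxx ≤ observation L t zt zx zxx := by
  have cb : Continuous fun t => zx t L ^ 2 + zx t (-L) ^ 2 := by
    have h1 : Continuous fun t => zx t L := czx.comp (by fun_prop : Continuous fun t => (t, L))
    have h2 : Continuous fun t => zx t (-L) := czx.comp (by fun_prop : Continuous fun t => (t, -L))
    fun_prop
  refine add_le_add ?_ ?_
  · refine intervalIntegral.integral_mono_interval le_rfl hs hst ?_ (cb.intervalIntegrable 0 t)
    exact Filter.Eventually.of_forall fun t => add_nonneg (sq_nonneg _) (sq_nonneg _)
  · refine setIntegral_mono_set (integrableOn_rect (by fun_prop))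
      (Filter.Eventually.of_forall fun t => sq_nonneg _) ?_
    exact (prod_mono (Icc_subset_Icc_right hst) subset_rfl).eventuallyLE

theorem observation_nonneg {L t : ℝ} (ht : 0 ≤ t) : 0 ≤ observation L t zt zx zxx :=
  add_nonneg (intervalIntegral.integral_nonneg ht fun _ _ => by positivity)
    (integral_nonneg fun _ => sq_nonneg _)

theorem gaussian_weight_sq (L t x : ℝ) :
    weight 2 (L ^ 2) 0 0 t x ^ 2 = Real.exp (-((L ^ 2 - x ^ 2) / (2 * t))) := by
  rw [weight_sq, phase]
  congr 1
  push_cast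
  rw [add_zero, zero_mul, add_zero, mul_comm 2 t, ← div_div]
  ring

/-- The case `n = 2`, `c = 0` is critical: the dissipation vanishes identically, so the Carleman
estimate still holds, but the potential is negative and this is only an upper bound for a quantity
without sign. It is uniform in `t` because the observation increases with the horizon. -/
theorem gaussian_energy_le {L t₀ : ℝ} (hL : 0 ≤ L) (hz : Jet z zt zx zxx ztx)
    (cz : Continuous fun p : ℝ × ℝ => z p.1 p.2) (czx : Continuous fun p : ℝ × ℝ => zx p.1 p.2)
    (czt : Continuous fun p : ℝ × ℝ => zt p.1 p.2)
    (czxx : Continuous fun p : ℝ × ℝ => zxx p.1 p.2)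
    (hl : ∀ t ∈ Icc 0 t₀, z t (-L) = 0) (hr : ∀ t ∈ Icc 0 t₀, z t L = 0)
    {t : ℝ} (ht : t ∈ Ioc 0 t₀) :
    t * ∫ x in -L..L, energyDensity 2 (L ^ 2) 0 0 z zx t x ≤
      (L + t₀ / 2) * observation L t₀ zt zx zxx := by
  have key := energy_le_observation (n := 2) le_rfl (A := L ^ 2) (c := 0) (x₀ := 0) (Y := L) hL
    le_rfl ht.1 (fun x hx => by nlinarith [hx.1, hx.2]) (fun x hx => by nlinarith [hx.1, hx.2])
    (by linarith) (by linarith) (fun t ht x hx => by simp [dissipation]; norm_num) hz cz czx czt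
    czxx (fun s hs => hl s ⟨hs.1, hs.2.trans ht.2⟩) (fun s hs => hr s ⟨hs.1, hs.2.trans ht.2⟩)
  have e : ((2 : ℕ) : ℝ) / 2 * L = L := by push_cast; ring
  rw [e] at key
  refine key.trans ((le_mul_observation ht.1.le hL (by linarith [ht.1])).trans ?_)
  have := observation_mono (L := L) ht.1.le ht.2 czx czt czxx
  have := observation_nonneg (L := L) (zt := zt) (zx := zx) (zxx := zxx) ht.1.le
  have := ht.2
  have := ht.1
  have : 0 ≤ L + t₀ / 2 := by linarith
  gcongr

/-- Combines the multiplier identity with the pointwise-in-time energy bound and the final-state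
bound `hfin`. The constant does not depend on `ε`, which allows `ε → 0` afterwards. -/
theorem weighted_integral_rect_le {L ε t₀ C : ℝ} (hL : 0 ≤ L)
    (hε : 0 < ε) (h0 : ε ≤ t₀) (hz : Jet z zt zx zxx ztx)
    (cz : Continuous fun p : ℝ × ℝ => z p.1 p.2) (czx : Continuous fun p : ℝ × ℝ => zx p.1 p.2)
    (czt : Continuous fun p : ℝ × ℝ => zt p.1 p.2)
    (czxx : Continuous fun p : ℝ × ℝ => zxx p.1 p.2)
    (hl : ∀ t ∈ Icc 0 t₀, z t (-L) = 0) (hr : ∀ t ∈ Icc 0 t₀, z t L = 0)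
    (hfin : ∫ x in -L..L, z t₀ x ^ 2 ≤ C * observation L t₀ zt zx zxx) :
    ∫ p in rect L ε t₀, z p.1 p.2 ^ 2 * Real.exp (-((L ^ 2 - p.2 ^ 2) / (2 * p.1))) ≤
      2 * (t₀ * C + 2 * t₀ ^ 2 + 2 * t₀ * (L + t₀ / 2)) * observation L t₀ zt zx zxx := by
  set K := observation L t₀ zt zx zxx with hK
  have t0p : 0 < t₀ := hε.trans_le h0
  have hK0 : 0 ≤ K := observation_nonneg t0p.le
  have hA : ∀ x ∈ Icc (-L) L, (x + 0) ^ 2 ≤ L ^ 2 := fun x hx => by nlinarith [hx.1, hx.2]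
  have key := integral_sq_le_energy hL hε h0 (hz.conj 2 (L ^ 2) 0 0)
    (G := fun t x => weight 2 (L ^ 2) 0 0 t x * (zt t x - zxx t x))
    (fun t ht x => by
      rw [conj_equation (z := z) (zx := zx) 2 (L ^ 2) 0 0 ht x]
      push_cast
      ring)
    (fun t ht => by simp [hl t ⟨hε.le.trans ht.1, ht.2⟩])
    (fun t ht => by simp [hr t ⟨hε.le.trans ht.1, ht.2⟩])
  have sub := rect_subset (L := L) (b := t₀) hε
  have cw := (continuousOn_weight 2 (L ^ 2) 0 0).mono sub
  have cV := (continuousOn_potential 2 (L ^ 2) 0 0).mono sub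
  have cX := (hz.conj 2 (L ^ 2) 0 0).cont_x.mono sub
  have i1 : ∫ x in -L..L, t₀ * (weight 2 (L ^ 2) 0 0 t₀ x * z t₀ x) ^ 2 ≤ t₀ * (C * K) := by
    rw [intervalIntegral.integral_const_mul]
    refine mul_le_mul_of_nonneg_left (le_trans ?_ hfin) t0p.le
    have c1 : Continuous fun x => z t₀ x := cz.comp (by fun_prop : Continuous fun x => (t₀, x))
    have c2 : Continuous fun x => weight 2 (L ^ 2) 0 0 t₀ x := by unfold weight phase; fun_prop
    refine intervalIntegral.integral_mono_on (neg_le_self hL)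
      ((by fun_prop : Continuous _).intervalIntegrable _ _)
      ((by fun_prop : Continuous _).intervalIntegrable _ _) fun x hx => ?_
    rw [mul_pow]
    exact mul_le_of_le_one_left (sq_nonneg _) (weight_sq_le_one le_rfl t0p.le (hA x hx))
  have i2 : ∫ p in rect L ε t₀, p.1 ^ 2 * ((weight 2 (L ^ 2) 0 0 p.1 p.2 *
      (zt p.1 p.2 - zxx p.1 p.2)) ^ 2 / 2) ≤ t₀ ^ 2 / 2 * K := by
    refine (source_term_le (n := 2) le_rfl hε h0 hA (czt.sub czxx)).trans ?_
    refine mul_le_mul_of_nonneg_left ?_ (by positivity)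
    exact le_add_of_nonneg_left
      (intervalIntegral.integral_nonneg t0p.le fun _ _ => by positivity)
  have cE : ContinuousOn (fun p : ℝ × ℝ => p.1 * energyDensity 2 (L ^ 2) 0 0 z zx p.1 p.2)
      (rect L ε t₀) := by
    unfold energyDensity; fun_prop
  have i3 : ∫ p in rect L ε t₀, p.1 * energyDensity 2 (L ^ 2) 0 0 z zx p.1 p.2 ≤
      (t₀ - ε) * ((L + t₀ / 2) * K) := by
    refine integral_rect_le hL h0 cE fun t ht => ?_
    rw [intervalIntegral.integral_const_mul]
    exact gaussian_energy_le hL hz cz czx czt czxx hl hr ⟨hε.trans_le ht.1, ht.2⟩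
  have e1 : ∫ p in rect L ε t₀, (2 * p.1 ^ 2 * (weight 2 (L ^ 2) 0 0 p.1 p.2 *
      (zt p.1 p.2 - zxx p.1 p.2)) ^ 2 + 2 * (p.1 * (conjX 2 (L ^ 2) 0 0 z zx p.1 p.2 ^ 2 +
        potential 2 (L ^ 2) 0 0 p.1 p.2 * (weight 2 (L ^ 2) 0 0 p.1 p.2 * z p.1 p.2) ^ 2))) =
      4 * (∫ p in rect L ε t₀, p.1 ^ 2 * ((weight 2 (L ^ 2) 0 0 p.1 p.2 *
      (zt p.1 p.2 - zxx p.1 p.2)) ^ 2 / 2)) +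
      2 * ∫ p in rect L ε t₀, p.1 * energyDensity 2 (L ^ 2) 0 0 z zx p.1 p.2 := by
    rw [← integral_const_mul, ← integral_const_mul, ← integral_add
      (integrableOn_rect (by fun_prop)) (integrableOn_rect (by fun_prop))]
    refine setIntegral_congr_fun (isCompact_rect _ _ _).measurableSet fun p _ => ?_
    simp only [energyDensity]
    ring
  have e2 : ∫ p in rect L ε t₀, (weight 2 (L ^ 2) 0 0 p.1 p.2 * z p.1 p.2) ^ 2 / 2 =
      (∫ p in rect L ε t₀, z p.1 p.2 ^ 2 * Real.exp (-((L ^ 2 - p.2 ^ 2) / (2 * p.1)))) / 2 := by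
    rw [← integral_div]
    refine setIntegral_congr_fun (isCompact_rect _ _ _).measurableSet fun p _ => ?_
    simp only [mul_pow, gaussian_weight_sq]
    ring
  have i4 : (t₀ - ε) * ((L + t₀ / 2) * K) ≤ t₀ * ((L + t₀ / 2) * K) := by
    have : 0 ≤ (L + t₀ / 2) * K := by positivity
    nlinarith
  rw [e1, e2] at key
  have : 0 ≤ t₀ ^ 2 * K := by positivity
  linarith

/-- At `t = 0` division by zero makes the exponent `0`, so the bound persists on the closed
rectangle. -/
theorem gaussian_le_one {L : ℝ} {t x : ℝ} (ht : 0 ≤ t) (hx : x ∈ Icc (-L) L) :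
    Real.exp (-((L ^ 2 - x ^ 2) / (2 * t))) ≤ 1 := by
  refine Real.exp_le_one_iff.2 ?_
  have h1 : 0 ≤ L ^ 2 - x ^ 2 := by nlinarith [hx.1, hx.2]
  have : 0 ≤ (L ^ 2 - x ^ 2) / (2 * t) := by positivity
  linarith

theorem integrableOn_mul_gaussian {L t₀ : ℝ} {f : ℝ × ℝ → ℝ} (cf : Continuous f) :
    IntegrableOn (fun p => f p * Real.exp (-((L ^ 2 - p.2 ^ 2) / (2 * p.1)))) (rect L 0 t₀) := by
  refine Integrable.mono (integrableOn_rect cf.continuousOn)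
    (Measurable.aestronglyMeasurable (by have := cf.measurable; fun_prop)) ?_
  refine (ae_restrict_iff' (isCompact_rect _ _ _).measurableSet).2
    (Filter.Eventually.of_forall fun p hp => ?_)
  rw [norm_mul, Real.norm_of_nonneg (Real.exp_pos _).le]
  exact mul_le_of_le_one_right (norm_nonneg _) (gaussian_le_one hp.1.1 hp.2)

/-- Weighted observability of the heat equation with a source term, for the Gaussian weight
`exp (-(L² - x²) / (2 t))`. -/
theorem exists_weighted_observability {L t₀ : ℝ} (hL : 0 < L) (h0 : 0 < t₀) :
    ∃ C, 0 ≤ C ∧ ∀ z zt zx zxx ztx : ℝ → ℝ → ℝ, Jet z zt zx zxx ztx →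
      (Continuous fun p : ℝ × ℝ => z p.1 p.2) → (Continuous fun p : ℝ × ℝ => zx p.1 p.2) →
      (Continuous fun p : ℝ × ℝ => zt p.1 p.2) → (Continuous fun p : ℝ × ℝ => zxx p.1 p.2) →
      (∀ t ∈ Icc 0 t₀, z t (-L) = 0) → (∀ t ∈ Icc 0 t₀, z t L = 0) →
      ∫ p in Ioo 0 t₀ ×ˢ Ioo (-L) L,
          z p.1 p.2 ^ 2 * Real.exp (-((L ^ 2 - p.2 ^ 2) / (2 * p.1))) ≤
        C * observation L t₀ zt zx zxx := by
  obtain ⟨C, hC, hobs⟩ := exists_integral_sq_le_observation hL h0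
  refine ⟨2 * (t₀ * C + 2 * t₀ ^ 2 + 2 * t₀ * (L + t₀ / 2)), by positivity, ?_⟩
  intro z zt zx zxx ztx hz cz czx czt czxx hl hr
  set f : ℝ × ℝ → ℝ := fun p => z p.1 p.2 ^ 2 * Real.exp (-((L ^ 2 - p.2 ^ 2) / (2 * p.1)))
    with hf
  have hfin := hobs z zt zx zxx ztx hz cz czx czt czxx hl hr
  -- Exhaustion of the cylinder by rectangles away from `t = 0`, where the phase is singular.
  set s : ℕ → Set (ℝ × ℝ) := fun k => rect L (t₀ / (k + 1)) t₀ with hs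
  have hle : ∀ k, ∫ p in s k, f p ≤
      2 * (t₀ * C + 2 * t₀ ^ 2 + 2 * t₀ * (L + t₀ / 2)) * observation L t₀ zt zx zxx := fun k =>
    weighted_integral_rect_le hL.le (by positivity)
      (div_le_self h0.le (by linarith [k.cast_nonneg (α := ℝ)])) hz cz czx czt czxx hl hr hfin
  have hsub : (⋃ k, s k) ⊆ rect L 0 t₀ := iUnion_subset fun k =>
    prod_mono (Icc_subset_Icc_left (by positivity)) subset_rfl
  have int_rect : IntegrableOn f (rect L 0 t₀) :=
    integrableOn_mul_gaussian (f := fun p => z p.1 p.2 ^ 2) (by fun_prop)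
  have int_union : IntegrableOn f (⋃ k, s k) := int_rect.mono_set hsub
  have hmono : Monotone s := fun i j hij => prod_mono (Icc_subset_Icc_left (by gcongr)) subset_rfl
  have lim := tendsto_setIntegral_of_monotone (s := s)
    (fun k => (isCompact_rect L (t₀ / (k + 1)) t₀).measurableSet) hmono int_union
  refine le_trans ?_ (le_of_tendsto' lim hle)
  refine setIntegral_mono_set int_union (Filter.Eventually.of_forall fun p => by
    show 0 ≤ f p
    simp only [hf]; positivity) (LE.le.eventuallyLE ?_)
  rintro p ⟨hp, hq⟩
  obtain ⟨k, hk⟩ := exists_nat_gt (t₀ / p.1)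
  refine mem_iUnion.2 ⟨k, ⟨?_, hp.2.le⟩, Ioo_subset_Icc_self hq⟩
  have := hp.1
  rw [div_lt_iff₀ this] at hk
  rw [div_le_iff₀ (by positivity)]
  nlinarith

end Estimates

/-! ### Partial derivatives of smooth complex functions -/

section Partials
variable {ψ : ℝ × ℝ → ℂ}

theorem hasDerivAt_dt (hψ : ContDiff ℝ ∞ ψ) (t x : ℝ) :
    HasDerivAt (fun s => ψ (s, x)) (dt ψ t x) t :=
  ((hψ.comp (by fun_prop : ContDiff ℝ ∞ fun s : ℝ => (s, x))).differentiable
    (by simp)).differentiableAt.hasDerivAt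

theorem hasDerivAt_dx (hψ : ContDiff ℝ ∞ ψ) (t x : ℝ) :
    HasDerivAt (fun y => ψ (t, y)) (dx ψ t x) x :=
  ((hψ.comp (by fun_prop : ContDiff ℝ ∞ fun y : ℝ => (t, y))).differentiable
    (by simp)).differentiableAt.hasDerivAt

theorem dt_eq_fderiv (hψ : ContDiff ℝ ∞ ψ) (t x : ℝ) : dt ψ t x = fderiv ℝ ψ (t, x) (1, 0) := by
  have h : HasFDerivAt ψ (fderiv ℝ ψ (t, x)) (t, x) :=
    (hψ.differentiable (by simp)).differentiableAt.hasFDerivAt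
  exact (h.comp_hasDerivAt t ((hasDerivAt_id t).prodMk (hasDerivAt_const t x))).deriv

theorem dx_eq_fderiv (hψ : ContDiff ℝ ∞ ψ) (t x : ℝ) : dx ψ t x = fderiv ℝ ψ (t, x) (0, 1) := by
  have h : HasFDerivAt ψ (fderiv ℝ ψ (t, x)) (t, x) :=
    (hψ.differentiable (by simp)).differentiableAt.hasFDerivAt
  exact (h.comp_hasDerivAt x ((hasDerivAt_const x t).prodMk (hasDerivAt_id x))).deriv

theorem contDiff_dt (hψ : ContDiff ℝ ∞ ψ) : ContDiff ℝ ∞ fun p : ℝ × ℝ => dt ψ p.1 p.2 := by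
  simp only [dt_eq_fderiv hψ]
  exact (hψ.fderiv_right (m := ∞) (by simp)).clm_apply contDiff_const

theorem contDiff_dx (hψ : ContDiff ℝ ∞ ψ) : ContDiff ℝ ∞ fun p : ℝ × ℝ => dx ψ p.1 p.2 := by
  simp only [dx_eq_fderiv hψ]
  exact (hψ.fderiv_right (m := ∞) (by simp)).clm_apply contDiff_const

theorem dxx_eq_dx_dx (ψ : ℝ × ℝ → ℂ) (t x : ℝ) :
    dxx ψ t x = dx (fun p : ℝ × ℝ => dx ψ p.1 p.2) t x := by
  simp only [dxx, dx, iteratedDeriv_succ, iteratedDeriv_zero]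

theorem contDiff_dxx (hψ : ContDiff ℝ ∞ ψ) : ContDiff ℝ ∞ fun p : ℝ × ℝ => dxx ψ p.1 p.2 := by
  simp only [dxx_eq_dx_dx]
  exact contDiff_dx (contDiff_dx hψ)

theorem dt_dx_comm (hψ : ContDiff ℝ ∞ ψ) (t x : ℝ) :
    dt (fun p : ℝ × ℝ => dx ψ p.1 p.2) t x = dx (fun p : ℝ × ℝ => dt ψ p.1 p.2) t x := by
  rw [dt_eq_fderiv (contDiff_dx hψ), dx_eq_fderiv (contDiff_dt hψ)]
  simp only [dt_eq_fderiv hψ, dx_eq_fderiv hψ, Prod.mk.eta]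
  have hd : DifferentiableAt ℝ (fderiv ℝ ψ) (t, x) :=
    ((hψ.fderiv_right (m := ∞) (by simp)).differentiable (by simp)).differentiableAt
  have hs : IsSymmSndFDerivAt ℝ ψ (t, x) :=
    (hψ.of_le (WithTop.coe_le_coe.2 le_top) : ContDiff ℝ 2 ψ).contDiffAt.isSymmSndFDerivAt (by simp)
  rw [fderiv_clm_apply hd (differentiableAt_const _), fderiv_clm_apply hd (differentiableAt_const _)]
  simpa using hs.eq (1, 0) (0, 1)

/-- Used with `ℓ` the real and the imaginary part: the operator has real coefficients, so the real
estimates apply to each separately and their squares add up. -/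
theorem jet_clm (hψ : ContDiff ℝ ∞ ψ) (ℓ : ℂ →L[ℝ] ℝ) :
    Jet (fun t x => ℓ (ψ (t, x))) (fun t x => ℓ (dt ψ t x)) (fun t x => ℓ (dx ψ t x))
      (fun t x => ℓ (dxx ψ t x)) (fun t x => ℓ (dx (fun p : ℝ × ℝ => dt ψ p.1 p.2) t x)) where
  t t _ x := ℓ.hasFDerivAt.comp_hasDerivAt t (hasDerivAt_dt hψ t x)
  x t _ x := ℓ.hasFDerivAt.comp_hasDerivAt x (hasDerivAt_dx hψ t x)
  xx t _ x := by
    have := ℓ.hasFDerivAt.comp_hasDerivAt x (hasDerivAt_dx (contDiff_dx hψ) t x)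
    rwa [← dxx_eq_dx_dx] at this
  xt t _ x := by
    have := ℓ.hasFDerivAt.comp_hasDerivAt t (hasDerivAt_dt (contDiff_dx hψ) t x)
    rwa [dt_dx_comm hψ] at this
  tx t _ x := ℓ.hasFDerivAt.comp_hasDerivAt x (hasDerivAt_dx (contDiff_dt hψ) t x)
  cont := (ℓ.continuous.comp hψ.continuous).continuousOn
  cont_t := (ℓ.continuous.comp (contDiff_dt hψ).continuous).continuousOn
  cont_x := (ℓ.continuous.comp (contDiff_dx hψ).continuous).continuousOn
  cont_xx := (ℓ.continuous.comp (contDiff_dxx hψ).continuous).continuousOn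
  cont_tx := (ℓ.continuous.comp (contDiff_dx (contDiff_dt hψ)).continuous).continuousOn

end Partials

/-! ### Observability for complex valued functions -/

/-- The open space-time cylinder `(0, T) × (-L, L)`. -/
abbrev cyl (L T : ℝ) : Set (ℝ × ℝ) := Ioo 0 T ×ˢ Ioo (-L) L

theorem cyl_subset_rect (L T : ℝ) : cyl L T ⊆ rect L 0 T :=
  prod_mono Ioo_subset_Icc_self Ioo_subset_Icc_self

theorem measurableSet_cyl (L T : ℝ) : MeasurableSet (cyl L T) :=
  measurableSet_Ioo.prod measurableSet_Ioo

theorem cyl_ae_eq_rect (L T : ℝ) : cyl L T =ᵐ[volume] rect L 0 T :=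
  Measure.set_prod_ae_eq Ioo_ae_eq_Icc Ioo_ae_eq_Icc

theorem integrableOn_cyl {E : Type*} [NormedAddCommGroup E] {L T : ℝ} {f : ℝ × ℝ → E}
    (hf : Continuous f) : IntegrableOn f (cyl L T) :=
  (integrableOn_rect hf.continuousOn).mono_set (cyl_subset_rect L T)

theorem integrableOn_Ioo_of_continuous {E : Type*} [NormedAddCommGroup E] {a b : ℝ} {f : ℝ → E}
    (hf : Continuous f) : IntegrableOn f (Ioo a b) :=
  hf.continuousOn.integrableOn_Icc.mono_set Ioo_subset_Icc_self

/-- The observation of a complex valued function: boundary observation plus source term. -/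
def obs (L T : ℝ) (ψ : ℝ × ℝ → ℂ) : ℝ :=
  (∫ t in Ioo 0 T, (‖dx ψ t L‖ ^ 2 + ‖dx ψ t (-L)‖ ^ 2)) +
    ∫ p in cyl L T, ‖dt ψ p.1 p.2 - dxx ψ p.1 p.2‖ ^ 2

theorem norm_sq_eq_re_im (a : ℂ) : ‖a‖ ^ 2 = Complex.reCLM a ^ 2 + Complex.imCLM a ^ 2 := by
  rw [Complex.sq_norm, Complex.normSq_apply]
  simp only [Complex.reCLM_apply, Complex.imCLM_apply]
  ring

theorem obs_eq {L T : ℝ} (hT : 0 ≤ T) {ψ : ℝ × ℝ → ℂ} (hψ : ContDiff ℝ ∞ ψ) :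
    obs L T ψ =
      observation L T (fun t x => Complex.reCLM (dt ψ t x)) (fun t x => Complex.reCLM (dx ψ t x))
        (fun t x => Complex.reCLM (dxx ψ t x)) +
      observation L T (fun t x => Complex.imCLM (dt ψ t x)) (fun t x => Complex.imCLM (dx ψ t x))
        (fun t x => Complex.imCLM (dxx ψ t x)) := by
  have c1 := (contDiff_dx hψ).continuous
  have c2 : Continuous fun p : ℝ × ℝ => dt ψ p.1 p.2 - dxx ψ p.1 p.2 :=
    (contDiff_dt hψ).continuous.sub (contDiff_dxx hψ).continuous
  have c3 : ∀ y, Continuous fun t => dx ψ t y := fun y =>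
    c1.comp (by fun_prop : Continuous fun t : ℝ => (t, y))
  have c4 := c3 L
  have c5 := c3 (-L)
  simp only [obs, observation, ← map_sub, intervalIntegral.integral_of_le hT,
    integral_Ioc_eq_integral_Ioo, ← setIntegral_congr_set (cyl_ae_eq_rect L T)]
  rw [add_add_add_comm, ← integral_add (integrableOn_Ioo_of_continuous (by fun_prop))
    (integrableOn_Ioo_of_continuous (by fun_prop)),
    ← integral_add (integrableOn_cyl (by fun_prop)) (integrableOn_cyl (by fun_prop))]
  congr 1
  · refine integral_congr_ae (Filter.Eventually.of_forall fun t => ?_)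
    simp only [norm_sq_eq_re_im]; ring
  · refine integral_congr_ae (Filter.Eventually.of_forall fun t => ?_)
    simp only [norm_sq_eq_re_im]

/-- Weighted observability for complex valued functions. -/
theorem exists_weighted_observability_complex {L t₀ : ℝ} (hL : 0 < L) (h0 : 0 < t₀) :
    ∃ C, 0 ≤ C ∧ ∀ ψ : ℝ × ℝ → ℂ, IsTest L t₀ ψ →
      ∫ p in cyl L t₀, ‖ψ p‖ ^ 2 * Real.exp (-((L ^ 2 - p.2 ^ 2) / (2 * p.1))) ≤
        C * obs L t₀ ψ := by
  obtain ⟨C, hC, h⟩ := exists_weighted_observability hL h0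
  refine ⟨C, hC, fun ψ hψ => ?_⟩
  have hs := hψ.smooth
  have c0 := hs.continuous
  have key : ∀ ℓ : ℂ →L[ℝ] ℝ, _ := fun ℓ => h _ _ _ _ _ (jet_clm hs ℓ) (by fun_prop)
    (ℓ.continuous.comp (contDiff_dx hs).continuous)
    (ℓ.continuous.comp (contDiff_dt hs).continuous)
    (ℓ.continuous.comp (contDiff_dxx hs).continuous)
    (fun t ht => by rw [hψ.left t ht, map_zero]) (fun t ht => by rw [hψ.right t ht, map_zero])
  rw [obs_eq h0.le hs, mul_add]
  refine le_trans (le_of_eq ?_) (add_le_add (key Complex.reCLM) (key Complex.imCLM))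
  have hi : ∀ ℓ : ℂ →L[ℝ] ℝ, IntegrableOn (fun p : ℝ × ℝ => ℓ (ψ (p.1, p.2)) ^ 2 *
      Real.exp (-((L ^ 2 - p.2 ^ 2) / (2 * p.1)))) (cyl L t₀) := fun ℓ =>
    (integrableOn_mul_gaussian (by fun_prop)).mono_set (cyl_subset_rect L t₀)
  rw [← integral_add (hi _) (hi _)]
  refine integral_congr_ae (Filter.Eventually.of_forall fun p => ?_)
  simp only [norm_sq_eq_re_im, Prod.mk.eta]; ring

/-! ### Duality between observability and reachability -/

/-- The bound forces `ker Λ ⊆ ker ℓ`, so `ℓ` factors through the range of `Λ`, where it is bounded;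
Hahn–Banach extends it to `E`. -/
theorem exists_strongDual_of_norm_le {V E : Type*} [AddCommGroup V] [Module ℂ V]
    [NormedAddCommGroup E] [NormedSpace ℂ E] (Λ : V →ₗ[ℂ] E) (ℓ : V →ₗ[ℂ] ℂ) (C : ℝ)
    (h : ∀ v, ‖ℓ v‖ ≤ C * ‖Λ v‖) : ∃ F : StrongDual ℂ E, ∀ v, F (Λ v) = ℓ v := by
  have hker : ℓ ∈ Λ.dualMap.range := by
    rw [LinearMap.range_dualMap_eq_dualAnnihilator_ker, Submodule.mem_dualAnnihilator]
    intro v hv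
    have := h v
    rw [LinearMap.mem_ker.1 hv, norm_zero, mul_zero] at this
    exact norm_le_zero_iff.1 this
  obtain ⟨m, hm⟩ := hker
  have hm' : ∀ v, m (Λ v) = ℓ v := fun v => congrArg (fun k => k v) hm
  obtain ⟨F, hF, -⟩ := exists_extension_norm_eq (𝕜 := ℂ) (LinearMap.range Λ)
    ((m.domRestrict (LinearMap.range Λ)).mkContinuous C (by
      rintro ⟨_, v, rfl⟩
      simpa [hm'] using h v))
  refine ⟨F, fun v => ?_⟩
  rw [hF ⟨Λ v, v, rfl⟩]
  exact hm' v

theorem norm_toLp_sq {α : Type*} [MeasurableSpace α] {μ : Measure α} {f : α → ℂ}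
    (hf : MemLp f 2 μ) : ‖hf.toLp f‖ ^ 2 = ∫ x, ‖f x‖ ^ 2 ∂μ := by
  have h : (inner ℂ (hf.toLp f) (hf.toLp f) : ℂ) = ((∫ x, ‖f x‖ ^ 2 ∂μ : ℝ) : ℂ) := by
    rw [L2.inner_def, ← integral_complex_ofReal]
    refine integral_congr_ae ?_
    filter_upwards [hf.coeFn_toLp] with x hx
    rw [hx, inner_self_eq_norm_sq_to_K]
    simp
  rw [inner_self_eq_norm_sq_to_K] at h
  exact Complex.ofReal_injective (by simpa using h)

theorem norm_state_sq {α : Type*} [MeasurableSpace α] {μ : Measure α} (f : Lp ℂ 2 μ) :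
    ‖f‖ ^ 2 = ∫ x, ‖f x‖ ^ 2 ∂μ := by
  rw [← norm_toLp_sq (Lp.memLp f), Lp.toLp_coeFn]

/-- Riesz representation, with the representing function conjugated so that the pairing is bilinear,
as in the definition of transposition solutions. -/
theorem exists_integral_mul_eq {α : Type*} [MeasurableSpace α] {μ : Measure α}
    (F : StrongDual ℂ (Lp ℂ 2 μ)) : ∃ h : α → ℂ, MemLp h 2 μ ∧
      ∀ (f : α → ℂ) (hf : MemLp f 2 μ), F (hf.toLp f) = ∫ x, h x * f x ∂μ := by
  set k := (InnerProductSpace.toDual ℂ (Lp ℂ 2 μ)).symm F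
  refine ⟨fun x => starRingEnd ℂ (k x), (Lp.memLp k).star, fun f hf => ?_⟩
  rw [← InnerProductSpace.toDual_symm_apply (𝕜 := ℂ) (y := F), L2.inner_def]
  refine integral_congr_ae ?_
  filter_upwards [hf.coeFn_toLp] with x hx
  rw [hx, RCLike.inner_apply, mul_comm]

theorem memLp_cyl {L T : ℝ} {f : ℝ × ℝ → ℂ} (hf : Continuous f) :
    MemLp f 2 (volume.restrict (cyl L T)) :=
  (memLp_two_iff_integrable_sq_norm hf.aestronglyMeasurable).2 (integrableOn_cyl (by fun_prop))

theorem memLp_Ioo {a b : ℝ} {f : ℝ → ℂ} (hf : Continuous f) :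
    MemLp f 2 (volume.restrict (Ioo a b)) :=
  (memLp_two_iff_integrable_sq_norm hf.aestronglyMeasurable).2
    (integrableOn_Ioo_of_continuous (by fun_prop))

section Linear
variable {φ ψ : ℝ × ℝ → ℂ}

theorem dt_add (hφ : ContDiff ℝ ∞ φ) (hψ : ContDiff ℝ ∞ ψ) (t x : ℝ) :
    dt (φ + ψ) t x = dt φ t x + dt ψ t x :=
  ((hasDerivAt_dt hφ t x).add (hasDerivAt_dt hψ t x)).deriv

theorem dx_add (hφ : ContDiff ℝ ∞ φ) (hψ : ContDiff ℝ ∞ ψ) (t x : ℝ) :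
    dx (φ + ψ) t x = dx φ t x + dx ψ t x :=
  ((hasDerivAt_dx hφ t x).add (hasDerivAt_dx hψ t x)).deriv

theorem dxx_add (hφ : ContDiff ℝ ∞ φ) (hψ : ContDiff ℝ ∞ ψ) (t x : ℝ) :
    dxx (φ + ψ) t x = dxx φ t x + dxx ψ t x := by
  simp only [dxx_eq_dx_dx, dx_add hφ hψ]
  exact dx_add (contDiff_dx hφ) (contDiff_dx hψ) t x

theorem dt_smul (c : ℂ) (hφ : ContDiff ℝ ∞ φ) (t x : ℝ) : dt (c • φ) t x = c * dt φ t x :=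
  ((hasDerivAt_dt hφ t x).const_mul c).deriv

theorem dx_smul (c : ℂ) (hφ : ContDiff ℝ ∞ φ) (t x : ℝ) : dx (c • φ) t x = c * dx φ t x :=
  ((hasDerivAt_dx hφ t x).const_mul c).deriv

theorem dxx_smul (c : ℂ) (hφ : ContDiff ℝ ∞ φ) (t x : ℝ) : dxx (c • φ) t x = c * dxx φ t x := by
  simp only [dxx_eq_dx_dx, dx_smul c hφ]
  exact dx_smul c (contDiff_dx hφ) t x

end Linear

/-- The space of test functions. -/
def tests (L T : ℝ) : Submodule ℂ (ℝ × ℝ → ℂ) where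
  carrier := {φ | IsTest L T φ}
  add_mem' hφ hψ := ⟨hφ.smooth.add hψ.smooth, fun t ht => by simp [hφ.left t ht, hψ.left t ht],
    fun t ht => by simp [hφ.right t ht, hψ.right t ht]⟩
  zero_mem' := ⟨contDiff_const, fun _ _ => rfl, fun _ _ => rfl⟩
  smul_mem' c _ hφ := ⟨hφ.smooth.const_smul c, fun t ht => by simp [hφ.left t ht],
    fun t ht => by simp [hφ.right t ht]⟩

theorem continuous_adjoint {φ : ℝ × ℝ → ℂ} (hφ : ContDiff ℝ ∞ φ) :
    Continuous fun p : ℝ × ℝ => -dt φ p.1 p.2 - dxx φ p.1 p.2 :=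
  (contDiff_dt hφ).continuous.neg.sub (contDiff_dxx hφ).continuous

theorem continuous_dx_slice {φ : ℝ × ℝ → ℂ} (hφ : ContDiff ℝ ∞ φ) (y : ℝ) :
    Continuous fun t => dx φ t y :=
  (contDiff_dx hφ).continuous.comp (by fun_prop : Continuous fun t : ℝ => (t, y))

/-- The source term and the two normal derivatives of a test function, as elements of `L²`. -/
def observe (L T : ℝ) : tests L T →ₗ[ℂ] Lp ℂ 2 (volume.restrict (cyl L T)) ×
    Lp ℂ 2 (volume.restrict (Ioo 0 T)) × Lp ℂ 2 (volume.restrict (Ioo 0 T)) where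
  toFun φ := ((memLp_cyl (continuous_adjoint φ.2.smooth)).toLp _,
    (memLp_Ioo (continuous_dx_slice φ.2.smooth (-L))).toLp _,
    (memLp_Ioo (continuous_dx_slice φ.2.smooth L)).toLp _)
  map_add' φ ψ := by
    simp only [Prod.mk_add_mk, ← MemLp.toLp_add]
    congr! 3
    · simp only [Submodule.coe_add, Pi.add_apply, dt_add φ.2.smooth ψ.2.smooth,
        dxx_add φ.2.smooth ψ.2.smooth]
      ring
    · funext t
      simp only [Submodule.coe_add, Pi.add_apply, dx_add φ.2.smooth ψ.2.smooth]
    · funext t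
      simp only [Submodule.coe_add, Pi.add_apply, dx_add φ.2.smooth ψ.2.smooth]
  map_smul' c φ := by
    simp only [Prod.smul_mk, RingHom.id_apply, ← MemLp.toLp_const_smul]
    congr! 3
    · simp only [Submodule.coe_smul, Pi.smul_apply, dt_smul c φ.2.smooth, dxx_smul c φ.2.smooth,
        smul_eq_mul]
      ring
    · funext t
      simp only [Submodule.coe_smul, Pi.smul_apply, dx_smul c φ.2.smooth, smul_eq_mul]
    · funext t
      simp only [Submodule.coe_smul, Pi.smul_apply, dx_smul c φ.2.smooth, smul_eq_mul]

/-- The pairing of a state with the final value of a test function. -/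
def finalPairing {L : ℝ} (T : ℝ) (f : State L) : tests L T →ₗ[ℂ] ℂ where
  toFun φ := ∫ x in Ioo (-L) L, f x * (φ : ℝ × ℝ → ℂ) (T, x)
  map_add' φ ψ := by
    have hi : ∀ φ : tests L T, Integrable (fun x => f x * (φ : ℝ × ℝ → ℂ) (T, x))
        (intervalMeasure L) := fun φ =>
      (Lp.memLp f).integrable_mul (memLp_Ioo (φ.2.smooth.continuous.comp
        (by fun_prop : Continuous fun x : ℝ => (T, x))))
    rw [← integral_add (hi φ) (hi ψ)]
    refine integral_congr_ae (Filter.Eventually.of_forall fun x => ?_)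
    simp [mul_add]
  map_smul' c φ := by
    rw [RingHom.id_apply, smul_eq_mul, ← integral_const_mul]
    refine integral_congr_ae (Filter.Eventually.of_forall fun x => ?_)
    simp only [Submodule.coe_smul, Pi.smul_apply, smul_eq_mul]
    ring

/-- The observation of a solution of the adjoint equation, which runs backward in time. -/
def adjointObs (L T : ℝ) (φ : ℝ × ℝ → ℂ) : ℝ :=
  (∫ t in Ioo 0 T, (‖dx φ t L‖ ^ 2 + ‖dx φ t (-L)‖ ^ 2)) +
    ∫ p in cyl L T, ‖-dt φ p.1 p.2 - dxx φ p.1 p.2‖ ^ 2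

/-- The product carries the sup norm, so each of the three squared `L²` norms costs one copy of the
total. -/
theorem adjointObs_le {L T : ℝ} (φ : tests L T) :
    adjointObs L T φ ≤ 3 * ‖observe L T φ‖ ^ 2 := by
  have h1 : ‖(observe L T φ).1‖ ≤ ‖observe L T φ‖ := norm_fst_le _
  have h2 : ‖(observe L T φ).2.1‖ ≤ ‖observe L T φ‖ := (norm_fst_le _).trans (norm_snd_le _)
  have h3 : ‖(observe L T φ).2.2‖ ≤ ‖observe L T φ‖ := (norm_snd_le _).trans (norm_snd_le _)
  have c1 := continuous_dx_slice φ.2.smooth L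
  have c2 := continuous_dx_slice φ.2.smooth (-L)
  have e1 : ‖(observe L T φ).1‖ ^ 2 = _ := norm_toLp_sq (memLp_cyl (continuous_adjoint φ.2.smooth))
  have e2 : ‖(observe L T φ).2.1‖ ^ 2 = _ :=
    norm_toLp_sq (memLp_Ioo (continuous_dx_slice φ.2.smooth (-L)))
  have e3 : ‖(observe L T φ).2.2‖ ^ 2 = _ :=
    norm_toLp_sq (memLp_Ioo (continuous_dx_slice φ.2.smooth L))
  rw [adjointObs, integral_add (integrableOn_Ioo_of_continuous (by fun_prop))
    (integrableOn_Ioo_of_continuous (by fun_prop)), ← e1, ← e2, ← e3]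
  have i1 := pow_le_pow_left₀ (norm_nonneg _) h1 2
  have i2 := pow_le_pow_left₀ (norm_nonneg _) h2 2
  have i3 := pow_le_pow_left₀ (norm_nonneg _) h3 2
  linarith

/-- Duality: a state is reachable as soon as its pairing with the final value of a test function is
controlled by the observation of that function. -/
theorem mem_reachableSetAt_of_norm_le {L T : ℝ} (f : State L) (C : ℝ) (hC : 0 ≤ C)
    (h : ∀ φ : ℝ × ℝ → ℂ, IsTest L T φ →
      ‖∫ x in Ioo (-L) L, f x * φ (T, x)‖ ≤ C * Real.sqrt (adjointObs L T φ)) :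
    f ∈ reachableSetAt L T := by
  obtain ⟨F, hF⟩ := exists_strongDual_of_norm_le (observe L T) (finalPairing T f)
    (C * Real.sqrt 3) (fun φ => by
      refine (h φ φ.2).trans ?_
      rw [mul_assoc]
      refine mul_le_mul_of_nonneg_left ?_ hC
      refine (Real.sqrt_le_sqrt (adjointObs_le φ)).trans_eq ?_
      rw [Real.sqrt_mul (by norm_num), Real.sqrt_sq (norm_nonneg _)])
  obtain ⟨u, hu, eu⟩ := exists_integral_mul_eq (F.comp (ContinuousLinearMap.inl ℂ _ _))
  obtain ⟨v, hv, ev⟩ := exists_integral_mul_eq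
    (F.comp ((ContinuousLinearMap.inr ℂ _ _).comp (ContinuousLinearMap.inl ℂ _ _)))
  obtain ⟨w, hw, ew⟩ := exists_integral_mul_eq
    (F.comp ((ContinuousLinearMap.inr ℂ _ _).comp (ContinuousLinearMap.inr ℂ _ _)))
  -- The three components of the functional are the controls and the solution; the signs are those
  -- of the transposition identity, where `u` stands on the left and the control at `L` enters with
  -- a minus.
  refine ⟨v, fun t => -w t, hv, hw.neg, fun p => -u p, hu.neg, fun φ hφ => ?_⟩
  have m1 := memLp_cyl (L := L) (T := T) (continuous_adjoint hφ.smooth)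
  have m2 := memLp_Ioo (a := 0) (b := T) (continuous_dx_slice hφ.smooth (-L))
  have m3 := memLp_Ioo (a := 0) (b := T) (continuous_dx_slice hφ.smooth L)
  have key := hF ⟨φ, hφ⟩
  have split : observe L T ⟨φ, hφ⟩ =
      ContinuousLinearMap.inl ℂ (Lp ℂ 2 (volume.restrict (cyl L T)))
        (Lp ℂ 2 (volume.restrict (Ioo 0 T)) × Lp ℂ 2 (volume.restrict (Ioo 0 T))) (m1.toLp _) +
      (ContinuousLinearMap.inr ℂ (Lp ℂ 2 (volume.restrict (cyl L T)))
        (Lp ℂ 2 (volume.restrict (Ioo 0 T)) × Lp ℂ 2 (volume.restrict (Ioo 0 T)))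
        (ContinuousLinearMap.inl ℂ _ _ (m2.toLp _)) +
      ContinuousLinearMap.inr ℂ (Lp ℂ 2 (volume.restrict (cyl L T)))
        (Lp ℂ 2 (volume.restrict (Ioo 0 T)) × Lp ℂ 2 (volume.restrict (Ioo 0 T)))
        (ContinuousLinearMap.inr ℂ _ _ (m3.toLp _))) := by
    simp [observe]
  rw [split, map_add, map_add] at key
  have k1 := eu _ m1
  have k2 := ev _ m2
  have k3 := ew _ m3
  simp only [ContinuousLinearMap.comp_apply] at k1 k2 k3
  rw [k1, k2, k3] at key
  have i2 : IntegrableOn (fun t => v t * dx φ t (-L)) (Ioo 0 T) := hv.integrable_mul m2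
  have i3 : IntegrableOn (fun t => w t * dx φ t L) (Ioo 0 T) := hw.integrable_mul m3
  have e : ∫ t in Ioo 0 T, (v t * dx φ t (-L) - -w t * dx φ t L) =
      (∫ t in Ioo 0 T, v t * dx φ t (-L)) + ∫ t in Ioo 0 T, w t * dx φ t L := by
    rw [← integral_add i2 i3]
    refine integral_congr_ae (Filter.Eventually.of_forall fun t => ?_)
    simp
  have e' : finalPairing T f ⟨φ, hφ⟩ = ∫ x in Ioo (-L) L, f x * φ (T, x) := rfl
  rw [e, ← e', ← key]
  simp only [neg_mul, integral_neg]
  ring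

theorem norm_integral_mul_le_sqrt {α : Type*} [MeasurableSpace α] {μ : Measure α} {f g : α → ℂ}
    (hf : MemLp f 2 μ) (hg : MemLp g 2 μ) :
    ‖∫ x, f x * g x ∂μ‖ ≤ Real.sqrt (∫ x, ‖f x‖ ^ 2 ∂μ) * Real.sqrt (∫ x, ‖g x‖ ^ 2 ∂μ) := by
  refine (norm_integral_le_integral_norm _).trans ?_
  have h := integral_mul_le_Lp_mul_Lq_of_nonneg (μ := μ) Real.HolderConjugate.two_two
    (f := fun x => ‖f x‖) (g := fun x => ‖g x‖)
    (Filter.Eventually.of_forall fun x => norm_nonneg _)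
    (Filter.Eventually.of_forall fun x => norm_nonneg _) (by simpa using hf.norm)
    (by simpa using hg.norm)
  simpa [Real.sqrt_eq_rpow] using h

/-! ### Time reversal -/

section Reversal

/-- The time reversal `(t, x) ↦ φ (T - t, x)`. -/
def reversed (T : ℝ) (φ : ℝ × ℝ → ℂ) : ℝ × ℝ → ℂ := fun p => φ (T - p.1, p.2)

variable {L T : ℝ} {φ : ℝ × ℝ → ℂ}

theorem IsTest.reversed (hφ : IsTest L T φ) : IsTest L T (reversed T φ) where
  smooth := hφ.smooth.comp (by fun_prop : ContDiff ℝ ∞ fun p : ℝ × ℝ => (T - p.1, p.2))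
  left t ht := hφ.left (T - t) ⟨by linarith [ht.2], by linarith [ht.1]⟩
  right t ht := hφ.right (T - t) ⟨by linarith [ht.2], by linarith [ht.1]⟩

theorem dt_reversed (hφ : ContDiff ℝ ∞ φ) (t x : ℝ) :
    dt (reversed T φ) t x = -dt φ (T - t) x := by
  have := (hasDerivAt_dt hφ (T - t) x).scomp t ((hasDerivAt_id t).const_sub T)
  exact this.deriv.trans (by simp)

theorem dx_reversed (t x : ℝ) : dx (reversed T φ) t x = dx φ (T - t) x := rfl

theorem dxx_reversed (t x : ℝ) : dxx (reversed T φ) t x = dxx φ (T - t) x := rfl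

theorem obs_reversed (hL : 0 ≤ L) (hT : 0 ≤ T) (hφ : ContDiff ℝ ∞ φ) :
    obs L T (reversed T φ) = adjointObs L T φ := by
  have c1 : Continuous fun p : ℝ × ℝ => ‖-dt φ p.1 p.2 - dxx φ p.1 p.2‖ ^ 2 :=
    (continuous_adjoint hφ).norm.pow 2
  have c2 : Continuous fun p : ℝ × ℝ => ‖-dt φ (T - p.1) p.2 - dxx φ (T - p.1) p.2‖ ^ 2 :=
    Continuous.comp (g := fun p : ℝ × ℝ => ‖-dt φ p.1 p.2 - dxx φ p.1 p.2‖ ^ 2)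
      (f := fun p : ℝ × ℝ => (T - p.1, p.2)) c1 (by fun_prop)
  simp only [obs, adjointObs, dt_reversed hφ, dx_reversed, dxx_reversed]
  congr 1
  · rw [← integral_Ioc_eq_integral_Ioo, ← intervalIntegral.integral_of_le hT,
      ← integral_Ioc_eq_integral_Ioo, ← intervalIntegral.integral_of_le hT]
    simpa using intervalIntegral.integral_comp_sub_left (a := 0) (b := T)
      (fun t => ‖dx φ t L‖ ^ 2 + ‖dx φ t (-L)‖ ^ 2) T
  · rw [setIntegral_congr_set (cyl_ae_eq_rect L T), setIntegral_congr_set (cyl_ae_eq_rect L T),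
      integral_rect hL hT c1.continuousOn, integral_rect hL hT c2.continuousOn]
    simpa using intervalIntegral.integral_comp_sub_left (a := 0) (b := T)
      (fun t => ∫ x in -L..L, ‖-dt φ t x - dxx φ t x‖ ^ 2) T

theorem obs_mono {s t : ℝ} (hst : s ≤ t) (hφ : ContDiff ℝ ∞ φ) : obs L s φ ≤ obs L t φ := by
  have c1 := continuous_dx_slice hφ L
  have c2 := continuous_dx_slice hφ (-L)
  have c3 := (contDiff_dt hφ).continuous
  have c4 := (contDiff_dxx hφ).continuous
  refine add_le_add ?_ ?_
  · refine setIntegral_mono_set (integrableOn_Ioo_of_continuous (by fun_prop))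
      (Filter.Eventually.of_forall fun t => add_nonneg (sq_nonneg _) (sq_nonneg _)) ?_
    exact (Ioo_subset_Ioo_right hst).eventuallyLE
  · refine setIntegral_mono_set (integrableOn_cyl (by fun_prop))
      (Filter.Eventually.of_forall fun t => sq_nonneg _) ?_
    exact (prod_mono (Ioo_subset_Ioo_right hst) subset_rfl).eventuallyLE

theorem source_le_obs (L T : ℝ) (ψ : ℝ × ℝ → ℂ) :
    ∫ p in cyl L T, ‖dt ψ p.1 p.2 - dxx ψ p.1 p.2‖ ^ 2 ≤ obs L T ψ :=
  le_add_of_nonneg_left (integral_nonneg fun _ => by positivity)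

theorem IsTest.mono {s : ℝ} (hφ : IsTest L T φ) (hs : s ≤ T) : IsTest L s φ where
  smooth := hφ.smooth
  left t ht := hφ.left t ⟨ht.1, ht.2.trans hs⟩
  right t ht := hφ.right t ⟨ht.1, ht.2.trans hs⟩

end Reversal

/-! ### Cutoff in time -/

section Cutoff

/-- A smooth cutoff in time, equal to `1` for `t ≤ t₀ / 2` and to `0` for `t ≥ t₀`. -/
def cutoff (t₀ t : ℝ) : ℝ := Real.smoothTransition (2 - 2 * t / t₀)

variable {t₀ : ℝ}

theorem contDiff_cutoff : ContDiff ℝ ∞ (cutoff t₀) :=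
  Real.smoothTransition.contDiff.comp (by fun_prop)

theorem cutoff_of_le (h0 : 0 < t₀) {t : ℝ} (ht : t ≤ t₀ / 2) : cutoff t₀ t = 1 := by
  refine Real.smoothTransition.one_of_one_le ?_
  have : 2 * t / t₀ ≤ 1 := by rw [div_le_one h0]; linarith
  linarith

theorem cutoff_of_ge (h0 : 0 < t₀) {t : ℝ} (ht : t₀ ≤ t) : cutoff t₀ t = 0 := by
  refine Real.smoothTransition.zero_of_nonpos ?_
  have : 2 ≤ 2 * t / t₀ := by rw [le_div_iff₀ h0]; linarith
  linarith

theorem abs_cutoff_le_one (t : ℝ) : |cutoff t₀ t| ≤ 1 := by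
  rw [cutoff, abs_of_nonneg (Real.smoothTransition.nonneg _)]
  exact Real.smoothTransition.le_one _

theorem deriv_cutoff_of_lt (h0 : 0 < t₀) {t : ℝ} (ht : t < t₀ / 2) : deriv (cutoff t₀) t = 0 := by
  have : cutoff t₀ =ᶠ[nhds t] fun _ => 1 := by
    filter_upwards [Iio_mem_nhds ht] with s hs using cutoff_of_le h0 (le_of_lt hs)
  rw [this.deriv_eq, deriv_const]

theorem deriv_cutoff_of_gt (h0 : 0 < t₀) {t : ℝ} (ht : t₀ < t) : deriv (cutoff t₀) t = 0 := by
  have : cutoff t₀ =ᶠ[nhds t] fun _ => 0 := by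
    filter_upwards [Ioi_mem_nhds ht] with s hs using cutoff_of_ge h0 (le_of_lt hs)
  rw [this.deriv_eq, deriv_const]

theorem exists_abs_deriv_cutoff_le (h0 : 0 < t₀) : ∃ D, 0 ≤ D ∧ ∀ t, |deriv (cutoff t₀) t| ≤ D := by
  have c : Continuous (deriv (cutoff t₀)) := contDiff_cutoff.continuous_deriv (by simp)
  obtain ⟨D, hD⟩ := (isCompact_Icc (a := t₀ / 2) (b := t₀)).exists_bound_of_continuousOn
    c.continuousOn
  refine ⟨max D 0, le_max_right _ _, fun t => ?_⟩
  rcases lt_or_ge t (t₀ / 2) with h | h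
  · simp [deriv_cutoff_of_lt h0 h]
  rcases lt_or_ge t₀ t with h' | h'
  · simp [deriv_cutoff_of_gt h0 h']
  · exact (hD t ⟨h, h'⟩).trans (le_max_left _ _)

/-- The product of a function with the cutoff in time. -/
def truncated (t₀ : ℝ) (ψ : ℝ × ℝ → ℂ) : ℝ × ℝ → ℂ := fun p => (cutoff t₀ p.1 : ℂ) * ψ p

variable {ψ : ℝ × ℝ → ℂ}

theorem contDiff_truncated (hψ : ContDiff ℝ ∞ ψ) : ContDiff ℝ ∞ (truncated t₀ ψ) :=
  (Complex.ofRealCLM.contDiff.comp (contDiff_cutoff.comp contDiff_fst)).mul hψ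

theorem truncated_of_ge (h0 : 0 < t₀) {p : ℝ × ℝ} (hp : t₀ ≤ p.1) : truncated t₀ ψ p = 0 := by
  simp [truncated, cutoff_of_ge h0 hp]

theorem norm_truncated_le (p : ℝ × ℝ) : ‖truncated t₀ ψ p‖ ≤ ‖ψ p‖ := by
  rw [truncated, norm_mul, Complex.norm_real, Real.norm_eq_abs]
  exact mul_le_of_le_one_left (norm_nonneg _) (abs_cutoff_le_one _)

/-- Lateral values of `ψ` are prescribed up to `t₀` only; beyond `t₀` the cutoff vanishes, so any
horizon `T` is allowed. -/
theorem IsTest.truncated {L T : ℝ} (h0 : 0 < t₀) (hψ : IsTest L t₀ ψ) :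
    IsTest L T (truncated t₀ ψ) where
  smooth := contDiff_truncated hψ.smooth
  left t ht := by
    rcases le_total t₀ t with h | h
    · exact truncated_of_ge h0 h
    · simp [HeatReach.truncated, hψ.left t ⟨ht.1, h⟩]
  right t ht := by
    rcases le_total t₀ t with h | h
    · exact truncated_of_ge h0 h
    · simp [HeatReach.truncated, hψ.right t ⟨ht.1, h⟩]

theorem heat_truncated (hψ : ContDiff ℝ ∞ ψ) (t x : ℝ) :
    dt (truncated t₀ ψ) t x - dxx (truncated t₀ ψ) t x =
      ((deriv (cutoff t₀) t : ℝ) : ℂ) * ψ (t, x) + (cutoff t₀ t : ℂ) * (dt ψ t x - dxx ψ t x) := by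
  have h1 : dt (truncated t₀ ψ) t x =
      ((deriv (cutoff t₀) t : ℝ) : ℂ) * ψ (t, x) + (cutoff t₀ t : ℂ) * dt ψ t x := by
    have d : HasDerivAt (fun s => (cutoff t₀ s : ℂ)) ((deriv (cutoff t₀) t : ℝ) : ℂ) t :=
      ((contDiff_cutoff.differentiable (by simp)).differentiableAt.hasDerivAt).ofReal_comp
    exact (d.mul (hasDerivAt_dt hψ t x)).deriv
  have h2 : ∀ t x, dx (truncated t₀ ψ) t x = (cutoff t₀ t : ℂ) * dx ψ t x := fun t x =>
    ((hasDerivAt_dx hψ t x).const_mul (cutoff t₀ t : ℂ)).deriv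
  have h3 : dxx (truncated t₀ ψ) t x = (cutoff t₀ t : ℂ) * dxx ψ t x := by
    simp only [dxx_eq_dx_dx, h2]
    exact ((hasDerivAt_dx (contDiff_dx hψ) t x).const_mul (cutoff t₀ t : ℂ)).deriv
  rw [h1, h3]; ring

end Cutoff

/-! ### Bounds for the two terms of the pairing -/

/-- Cauchy–Schwarz after inserting `e^{a} e^{-a} = 1` with `a = (L² - x²)/(4t)`: the growing weight
goes to `g`, the decaying one to `ψ`. -/
theorem source_pairing_le {L T t₀ : ℝ} (h0 : 0 < t₀) (hT : t₀ ≤ T)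
    {g : ℝ × ℝ → ℂ} (hg : MemLp g 2 (volume.restrict (Ioi 0 ×ˢ Ioo (-L) L)))
    (hgw : IntegrableOn (fun p : ℝ × ℝ => ‖g p‖ ^ 2 * Real.exp ((L ^ 2 - p.2 ^ 2) / (2 * p.1)))
      (Ioi 0 ×ˢ Ioo (-L) L)) {ψ : ℝ × ℝ → ℂ} (hψ : Continuous ψ) :
    ‖∫ p in cyl L T, g p * truncated t₀ ψ p‖ ≤
      Real.sqrt (∫ p in Ioi 0 ×ˢ Ioo (-L) L,
        ‖g p‖ ^ 2 * Real.exp ((L ^ 2 - p.2 ^ 2) / (2 * p.1))) *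
      Real.sqrt (∫ p in cyl L t₀, ‖ψ p‖ ^ 2 * Real.exp (-((L ^ 2 - p.2 ^ 2) / (2 * p.1)))) := by
  have hsub : cyl L t₀ ⊆ Ioi 0 ×ˢ Ioo (-L) L := prod_mono Ioo_subset_Ioi_self subset_rfl
  have hsubT : cyl L t₀ ⊆ cyl L T := prod_mono (Ioo_subset_Ioo_right hT) subset_rfl
  have e0 : ∫ p in cyl L T, g p * truncated t₀ ψ p = ∫ p in cyl L t₀, g p * truncated t₀ ψ p := by
    refine setIntegral_eq_of_subset_of_forall_sdiff_eq_zero (measurableSet_cyl L T) hsubT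
      fun p hp => ?_
    have : t₀ ≤ p.1 := by
      by_contra h
      exact hp.2 ⟨⟨hp.1.1.1, not_le.1 h⟩, hp.1.2⟩
    rw [truncated_of_ge h0 this, mul_zero]
  set a : ℝ × ℝ → ℝ := fun p => (L ^ 2 - p.2 ^ 2) / (2 * p.1) / 2 with ha
  have ma : Measurable a := by fun_prop
  have e1 : ∀ p, Real.exp (a p) ^ 2 = Real.exp ((L ^ 2 - p.2 ^ 2) / (2 * p.1)) := fun p => by
    rw [← Real.exp_nat_mul]; congr 1; simp only [ha]; push_cast; ring
  have e2 : ∀ p, Real.exp (-a p) ^ 2 = Real.exp (-((L ^ 2 - p.2 ^ 2) / (2 * p.1))) := fun p => by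
    rw [← Real.exp_nat_mul]; congr 1; simp only [ha]; push_cast; ring
  have n1 : ∀ p, ‖g p * (Real.exp (a p) : ℂ)‖ ^ 2 =
      ‖g p‖ ^ 2 * Real.exp ((L ^ 2 - p.2 ^ 2) / (2 * p.1)) := fun p => by
    rw [norm_mul, mul_pow, Complex.norm_real, Real.norm_of_nonneg (Real.exp_pos _).le, e1]
  have n2 : ∀ p, ‖truncated t₀ ψ p * (Real.exp (-a p) : ℂ)‖ ^ 2 =
      ‖truncated t₀ ψ p‖ ^ 2 * Real.exp (-((L ^ 2 - p.2 ^ 2) / (2 * p.1))) := fun p => by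
    rw [norm_mul, mul_pow, Complex.norm_real, Real.norm_of_nonneg (Real.exp_pos _).le, e2]
  have ctr : Continuous (truncated t₀ ψ) :=
    (Complex.continuous_ofReal.comp (contDiff_cutoff.continuous.comp continuous_fst)).mul hψ
  have i1 : IntegrableOn (fun p : ℝ × ℝ => ‖truncated t₀ ψ p‖ ^ 2 *
      Real.exp (-((L ^ 2 - p.2 ^ 2) / (2 * p.1)))) (cyl L t₀) :=
    (integrableOn_mul_gaussian (by fun_prop)).mono_set (cyl_subset_rect L t₀)
  have i2 : IntegrableOn (fun p : ℝ × ℝ => ‖ψ p‖ ^ 2 *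
      Real.exp (-((L ^ 2 - p.2 ^ 2) / (2 * p.1)))) (cyl L t₀) :=
    (integrableOn_mul_gaussian (by fun_prop)).mono_set (cyl_subset_rect L t₀)
  have m1 : MemLp (fun p => g p * (Real.exp (a p) : ℂ)) 2 (volume.restrict (cyl L t₀)) := by
    refine (memLp_two_iff_integrable_sq_norm ?_).2 ?_
    · exact (hg.1.mono_measure (Measure.restrict_mono hsub le_rfl)).mul
        (Measurable.aestronglyMeasurable (by fun_prop))
    · simp only [n1]; exact hgw.mono_set hsub
  have m2 : MemLp (fun p => truncated t₀ ψ p * (Real.exp (-a p) : ℂ)) 2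
      (volume.restrict (cyl L t₀)) := by
    refine (memLp_two_iff_integrable_sq_norm ?_).2 ?_
    · exact ctr.aestronglyMeasurable.mul (Measurable.aestronglyMeasurable (by fun_prop))
    · simp only [n2]; exact i1
  have e3 : ∫ p in cyl L t₀, g p * truncated t₀ ψ p = ∫ p in cyl L t₀,
      (g p * (Real.exp (a p) : ℂ)) * (truncated t₀ ψ p * (Real.exp (-a p) : ℂ)) := by
    refine integral_congr_ae (Filter.Eventually.of_forall fun p => ?_)
    have : (Real.exp (a p) : ℂ) * (Real.exp (-a p) : ℂ) = 1 := by
      rw [← Complex.ofReal_mul, ← Real.exp_add]; simp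
    linear_combination -(g p * truncated t₀ ψ p) * this
  rw [e0, e3]
  refine (norm_integral_mul_le_sqrt m1 m2).trans ?_
  simp only [n1, n2]
  refine mul_le_mul (Real.sqrt_le_sqrt ?_) (Real.sqrt_le_sqrt ?_) (Real.sqrt_nonneg _)
    (Real.sqrt_nonneg _)
  · exact setIntegral_mono_set hgw (Filter.Eventually.of_forall fun p => by positivity)
      (LE.le.eventuallyLE hsub)
  · refine integral_mono i1 i2 fun p => ?_
    have := norm_truncated_le (t₀ := t₀) (ψ := ψ) p
    simp only
    gcongr

/-- The commutator with the cutoff is `χ'ψ`, supported in `t₀/2 ≤ t ≤ t₀`, where the Gaussian weight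
is at least `exp(-L²/t₀)`; it can therefore be inserted at the price of a constant. -/
theorem integral_heat_truncated_sq_le {L T t₀ D : ℝ} (h0 : 0 < t₀) (hT : t₀ ≤ T)
    (hD : ∀ t, |deriv (cutoff t₀) t| ≤ D) {ψ : ℝ × ℝ → ℂ} (hψ : ContDiff ℝ ∞ ψ) :
    ∫ p in cyl L T, ‖dt (truncated t₀ ψ) p.1 p.2 - dxx (truncated t₀ ψ) p.1 p.2‖ ^ 2 ≤
      2 * D ^ 2 * Real.exp (L ^ 2 / t₀) *
        (∫ p in cyl L t₀, ‖ψ p‖ ^ 2 * Real.exp (-((L ^ 2 - p.2 ^ 2) / (2 * p.1)))) +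
      2 * ∫ p in cyl L t₀, ‖dt ψ p.1 p.2 - dxx ψ p.1 p.2‖ ^ 2 := by
  have hsubT : cyl L t₀ ⊆ cyl L T := prod_mono (Ioo_subset_Ioo_right hT) subset_rfl
  have c0 := hψ.continuous
  have c1 := (contDiff_dt hψ).continuous
  have c2 := (contDiff_dxx hψ).continuous
  have c3 := (contDiff_dt (contDiff_truncated (t₀ := t₀) hψ)).continuous
  have c4 := (contDiff_dxx (contDiff_truncated (t₀ := t₀) hψ)).continuous
  have i2 : IntegrableOn (fun p : ℝ × ℝ => ‖ψ p‖ ^ 2 *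
      Real.exp (-((L ^ 2 - p.2 ^ 2) / (2 * p.1)))) (cyl L t₀) :=
    (integrableOn_mul_gaussian (by fun_prop)).mono_set (cyl_subset_rect L t₀)
  have i3 : IntegrableOn (fun p : ℝ × ℝ => ‖dt ψ p.1 p.2 - dxx ψ p.1 p.2‖ ^ 2) (cyl L t₀) :=
    integrableOn_cyl (by fun_prop)
  have hae : ∀ᵐ p : ℝ × ℝ, p.1 ≠ t₀ := by
    have : volume ({t₀} ×ˢ univ : Set (ℝ × ℝ)) = 0 := by
      rw [Measure.volume_eq_prod, Measure.prod_prod]; simp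
    rw [ae_iff]
    refine measure_mono_null (fun p hp => ?_) this
    simpa using hp
  have e0 : ∫ p in cyl L T, ‖dt (truncated t₀ ψ) p.1 p.2 - dxx (truncated t₀ ψ) p.1 p.2‖ ^ 2 =
      ∫ p in cyl L t₀, ‖dt (truncated t₀ ψ) p.1 p.2 - dxx (truncated t₀ ψ) p.1 p.2‖ ^ 2 := by
    refine setIntegral_eq_of_subset_of_ae_sdiff_eq_zero (measurableSet_cyl L T).nullMeasurableSet
      hsubT ?_
    filter_upwards [hae] with p hne hp
    have : t₀ < p.1 := by
      by_contra h
      exact hp.2 ⟨⟨hp.1.1.1, lt_of_le_of_ne (not_lt.1 h) hne⟩, hp.1.2⟩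
    simp [heat_truncated hψ, deriv_cutoff_of_gt h0 this, cutoff_of_ge h0 this.le]
  rw [e0, ← integral_const_mul, ← integral_const_mul, ← integral_add (i2.const_mul _)
    (i3.const_mul _)]
  refine setIntegral_mono_on (integrableOn_cyl (by fun_prop))
    ((i2.const_mul _).add (i3.const_mul _)) (measurableSet_cyl L t₀) fun p hp => ?_
  rw [heat_truncated hψ]
  have s1 : ‖((deriv (cutoff t₀) p.1 : ℝ) : ℂ) * ψ (p.1, p.2)‖ ^ 2 ≤
      D ^ 2 * Real.exp (L ^ 2 / t₀) *
        (‖ψ p‖ ^ 2 * Real.exp (-((L ^ 2 - p.2 ^ 2) / (2 * p.1)))) := by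
    rcases lt_or_ge p.1 (t₀ / 2) with h | h
    · rw [deriv_cutoff_of_lt h0 h, Complex.ofReal_zero, zero_mul, norm_zero, zero_pow two_ne_zero]
      positivity
    · have hp1 : 0 < p.1 := hp.1.1
      have w1 : (L ^ 2 - p.2 ^ 2) / (2 * p.1) ≤ L ^ 2 / t₀ :=
        div_le_div₀ (sq_nonneg L) (by nlinarith [sq_nonneg p.2]) h0 (by linarith)
      have w2 : 1 ≤ Real.exp (L ^ 2 / t₀) * Real.exp (-((L ^ 2 - p.2 ^ 2) / (2 * p.1))) := by
        rw [← Real.exp_add]; exact Real.one_le_exp (by linarith)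
      have w3 : deriv (cutoff t₀) p.1 ^ 2 ≤ D ^ 2 := by
        rw [← sq_abs]; exact pow_le_pow_left₀ (abs_nonneg _) (hD _) 2
      rw [norm_mul, mul_pow, Complex.norm_real, Real.norm_eq_abs, sq_abs, Prod.mk.eta]
      calc _ ≤ D ^ 2 * ‖ψ p‖ ^ 2 * 1 := by rw [mul_one]; gcongr
        _ ≤ D ^ 2 * ‖ψ p‖ ^ 2 *
            (Real.exp (L ^ 2 / t₀) * Real.exp (-((L ^ 2 - p.2 ^ 2) / (2 * p.1)))) := by gcongr
        _ = _ := by ring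
  have s2 : ‖(cutoff t₀ p.1 : ℂ) * (dt ψ p.1 p.2 - dxx ψ p.1 p.2)‖ ^ 2 ≤
      ‖dt ψ p.1 p.2 - dxx ψ p.1 p.2‖ ^ 2 := by
    refine pow_le_pow_left₀ (norm_nonneg _) ?_ 2
    rw [norm_mul, Complex.norm_real, Real.norm_eq_abs]
    exact mul_le_of_le_one_left (norm_nonneg _) (abs_cutoff_le_one _)
  have s3 := pow_le_pow_left₀ (norm_nonneg _) (norm_add_le
    (((deriv (cutoff t₀) p.1 : ℝ) : ℂ) * ψ (p.1, p.2))
    ((cutoff t₀ p.1 : ℂ) * (dt ψ p.1 p.2 - dxx ψ p.1 p.2))) 2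
  have s4 := sq_nonneg (‖((deriv (cutoff t₀) p.1 : ℝ) : ℂ) * ψ (p.1, p.2)‖ -
    ‖(cutoff t₀ p.1 : ℂ) * (dt ψ p.1 p.2 - dxx ψ p.1 p.2)‖)
  nlinarith

/-- Cauchy–Schwarz in `x` at each fixed time, then in `t` against the constant `B`. The iterated
form makes joint measurability of `w` in `(t, x)` unnecessary. -/
theorem state_pairing_le {L T B : ℝ} (hT : 0 ≤ T) (hB : 0 ≤ B) {w : ℝ → State L}
    (hw : ∀ t ∈ Ioo 0 T, ‖w t‖ ≤ B) {S : ℝ × ℝ → ℂ} (hS : Continuous S) :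
    ‖∫ t in Ioo 0 T, ∫ x in Ioo (-L) L, w t x * S (t, x)‖ ≤
      B * Real.sqrt T * Real.sqrt (∫ p in cyl L T, ‖S p‖ ^ 2) := by
  set m : ℝ → ℝ := fun t => ∫ x in Ioo (-L) L, ‖S (t, x)‖ ^ 2 with hm
  have cS : ∀ t, Continuous fun x => S (t, x) := fun t => by fun_prop
  have m0 : ∀ t, 0 ≤ m t := fun t => integral_nonneg fun x => sq_nonneg _
  have hi : Integrable (fun p => ‖S p‖ ^ 2)
      ((volume.restrict (Ioo 0 T)).prod (volume.restrict (Ioo (-L) L))) := by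
    rw [Measure.prod_restrict]; exact integrableOn_cyl (by fun_prop)
  have im : Integrable m (volume.restrict (Ioo 0 T)) := hi.integral_prod_left
  have em : ∫ p in cyl L T, ‖S p‖ ^ 2 = ∫ t in Ioo 0 T, m t :=
    setIntegral_prod _ (integrableOn_cyl (by fun_prop))
  have ms : MemLp (fun t => ((Real.sqrt (m t) : ℝ) : ℂ)) 2 (volume.restrict (Ioo 0 T)) := by
    refine (memLp_two_iff_integrable_sq_norm ?_).2 ?_
    · exact Complex.continuous_ofReal.comp_aestronglyMeasurable
        (Real.continuous_sqrt.comp_aestronglyMeasurable im.1)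
    · refine im.congr (Filter.Eventually.of_forall fun t => ?_)
      simp [Real.sq_sqrt (m0 t)]
  have mc : MemLp (fun _ : ℝ => (B : ℂ)) 2 (volume.restrict (Ioo 0 T)) :=
    memLp_Ioo continuous_const
  have ib : Integrable (fun t => B * Real.sqrt (m t)) (volume.restrict (Ioo 0 T)) := by
    have := (mc.integrable_mul ms).norm
    refine this.congr (Filter.Eventually.of_forall fun t => ?_)
    simp [abs_of_nonneg hB, abs_of_nonneg (Real.sqrt_nonneg _)]
  have b1 : ‖∫ t in Ioo 0 T, ∫ x in Ioo (-L) L, w t x * S (t, x)‖ ≤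
      ∫ t in Ioo 0 T, B * Real.sqrt (m t) := by
    refine norm_integral_le_of_norm_le ib ((ae_restrict_iff' measurableSet_Ioo).2
      (Filter.Eventually.of_forall fun t ht => ?_))
    refine (norm_integral_mul_le_sqrt (Lp.memLp (w t)) (memLp_Ioo (cS t))).trans ?_
    rw [← norm_state_sq, Real.sqrt_sq (norm_nonneg _)]
    exact mul_le_mul_of_nonneg_right (hw t ht) (Real.sqrt_nonneg _)
  -- The real integral is viewed as a complex one so that the same Cauchy–Schwarz inequality serves
  -- in time.
  have b2 : ∫ t in Ioo 0 T, B * Real.sqrt (m t) ≤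
      ‖∫ t in Ioo 0 T, (B : ℂ) * ((Real.sqrt (m t) : ℝ) : ℂ)‖ := by
    have : ∫ t in Ioo 0 T, (B : ℂ) * ((Real.sqrt (m t) : ℝ) : ℂ) =
        ((∫ t in Ioo 0 T, B * Real.sqrt (m t) : ℝ) : ℂ) := by
      rw [← integral_complex_ofReal]
      simp only [Complex.ofReal_mul]
    rw [this, Complex.norm_real]
    exact Real.le_norm_self _
  refine (b1.trans (b2.trans (norm_integral_mul_le_sqrt mc ms))).trans_eq ?_
  rw [em]
  congr 1
  · have : ∫ _ in Ioo 0 T, ‖(B : ℂ)‖ ^ 2 = B ^ 2 * T := by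
      simp [hT]; ring
    rw [this, Real.sqrt_mul (sq_nonneg B), Real.sqrt_sq hB]
  · congr 1
    refine integral_congr_ae (Filter.Eventually.of_forall fun t => ?_)
    simp [Real.sq_sqrt (m0 t)]

end HeatReach

end

/-! ### Conclusion -/

open HeatReach

theorem lemma2 (L T : ℝ) (hL : 0 < L) (hT : L ^ 2 < Real.pi * T)
    (g : ℝ × ℝ → ℂ)
    (hg : MemLp g 2 (volume.restrict (Ioi 0 ×ˢ Ioo (-L) L)))
    (hgw : IntegrableOn
      (fun p : ℝ × ℝ => ‖g p‖ ^ 2 * Real.exp ((L ^ 2 - p.2 ^ 2) / (2 * p.1)))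
      (Ioi 0 ×ˢ Ioo (-L) L))
    (wT : HeatReach.State L) (w : ℝ → HeatReach.State L)
    (hw : HeatReach.IsBackwardSolution L T g wT w) :
    w 0 ∈ HeatReach.reachableSet L := by
  have hTpos : 0 < T := by
    by_contra h
    nlinarith [Real.pi_pos, sq_nonneg L]
  refine mem_iInter.2 fun τ => mem_iInter.2 fun hτ => ?_
  -- `t₀ ≤ τ` lets the observation on `(0, τ)` dominate; `t₀ ≤ T` makes the truncated test function
  -- vanish at time `T`, which removes `wT`.
  set t₀ := min τ T with ht₀
  have h0 : 0 < t₀ := lt_min hτ hTpos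
  obtain ⟨C, hC, hobs⟩ := exists_weighted_observability_complex hL h0
  obtain ⟨D, -, hD⟩ := exists_abs_deriv_cutoff_le h0
  obtain ⟨B, hB⟩ := isCompact_Icc.exists_bound_of_continuousOn hw.continuousOn
  have hB0 : 0 ≤ B := (norm_nonneg _).trans (hB 0 ⟨le_rfl, hTpos.le⟩)
  set M := ∫ p in Ioi 0 ×ˢ Ioo (-L) L,
    ‖g p‖ ^ 2 * Real.exp ((L ^ 2 - p.2 ^ 2) / (2 * p.1)) with hM
  set N := 2 * D ^ 2 * Real.exp (L ^ 2 / t₀) * C + 2 with hN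
  refine mem_reachableSetAt_of_norm_le (w 0)
    (Real.sqrt M * Real.sqrt C + B * Real.sqrt T * Real.sqrt N) (by positivity) fun φ hφ => ?_
  -- Reversal moves the final value `φ(τ)` to time `0`, where it meets `w 0`, and turns the adjoint
  -- operator into the forward heat operator.
  set ψ := reversed τ φ with hψdef
  have hψ : IsTest L t₀ ψ := hφ.reversed.mono (min_le_left _ _)
  have hK : obs L t₀ ψ ≤ adjointObs L τ φ :=
    (obs_mono (min_le_left _ _) hψ.smooth).trans_eq (obs_reversed hL.le hτ.le hφ.smooth)
  set K := adjointObs L τ φ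
  have hobsψ := (hobs ψ hψ).trans (mul_le_mul_of_nonneg_left hK hC)
  have hid := hw.identity (truncated t₀ ψ) (hψ.truncated h0)
  have z1 : ∫ x in Ioo (-L) L, wT x * truncated t₀ ψ (T, x) = 0 := by
    simp [truncated_of_ge h0 (p := (T, _)) (min_le_right τ T)]
  have z2 : ∫ x in Ioo (-L) L, w 0 x * truncated t₀ ψ (0, x) =
      ∫ x in Ioo (-L) L, w 0 x * φ (τ, x) := by
    simp [truncated, cutoff_of_le h0 (t := 0) (by positivity), hψdef, reversed]
  rw [z1, z2, add_zero] at hid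
  -- The cutoff equals `1` at time `0`, so the pairing to be bounded is what remains of the weak
  -- identity for `w`.
  have hpair : ∫ x in Ioo (-L) L, w 0 x * φ (τ, x) =
      (∫ p in cyl L T, g p * truncated t₀ ψ p) - ∫ t in Ioo 0 T, ∫ x in Ioo (-L) L,
        w t x * (dt (truncated t₀ ψ) t x - dxx (truncated t₀ ψ) t x) := by
    rw [hid]; ring
  have p1 := source_pairing_le h0 (min_le_right τ T) hg hgw hψ.smooth.continuous
  have p2 := state_pairing_le hTpos.le hB0 (fun t ht => hB t (Ioo_subset_Icc_self ht))
    (S := fun p => dt (truncated t₀ ψ) p.1 p.2 - dxx (truncated t₀ ψ) p.1 p.2)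
    ((contDiff_dt (contDiff_truncated hψ.smooth)).continuous.sub
      (contDiff_dxx (contDiff_truncated hψ.smooth)).continuous)
  have p3 : ∫ p in cyl L T, ‖dt (truncated t₀ ψ) p.1 p.2 - dxx (truncated t₀ ψ) p.1 p.2‖ ^ 2 ≤
      N * K := by
    refine (integral_heat_truncated_sq_le h0 (min_le_right τ T) hD hψ.smooth).trans ?_
    have a1 := mul_le_mul_of_nonneg_left hobsψ
      (by positivity : 0 ≤ 2 * D ^ 2 * Real.exp (L ^ 2 / t₀))
    have a2 := (source_le_obs L t₀ ψ).trans hK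
    rw [hN]
    linarith
  rw [hpair]
  refine (norm_sub_le _ _).trans ?_
  have q1 := p1.trans (mul_le_mul_of_nonneg_left (Real.sqrt_le_sqrt hobsψ) (Real.sqrt_nonneg _))
  have q2 := p2.trans (mul_le_mul_of_nonneg_left (Real.sqrt_le_sqrt p3) (by positivity))
  rw [Real.sqrt_mul hC] at q1
  rw [Real.sqrt_mul (by positivity)] at q2
  refine (add_le_add q1 q2).trans_eq ?_
  ring
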